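/- Let $(\Omega,\mathcal F,\mathbb Q)$ be a probability space, $\lambda,T,a,b>0$, $\sigma_0^2>0$ a constant, and $Z$ a subordinator (nondecreasing Lévy process). Let $\sigma^2$ solve $d\sigma_t^2=-\lambda\sigma_t^2\,dt+dZ_{\lambda t}$ with initial value $\sigma_0^2$. Suppose that it is an inverse Gaussian Ornstein--Uhlenbeck process with parameters $a,b$: the stationary distribution of this dynamics is $\mathrm{IG}(a,b)$, with density $\frac{a}{\sqrt{2\pi}}e^{ab}x^{-3/2}e^{-\frac12(a^2/x+b^2x)}$ on $(0,\infty)$. Put $I_T=\int_0^T\sigma_s^2\,ds$, $\kappa(\theta)=\ln E_{\mathbb Q}[e^{\theta Z_1}]$ and, for $\rho\le 0$, $$G_N=E_{\mathbb Q}\Big[\Big(-\lambda T\kappa(\rho)\big(\tfrac12e^{-\lambda T\kappa(\rho)}+\tfrac12\big)+|\rho|Z_{\lambda T}\Big)^N\Big].$$ **Theorem.** For every integer $N\ge1$ there are real polynomials $f_N$ (in 4 variables) and $g_N$ (in 6 variables) with nonnegative coefficients, depending only on $N$, such that in every such model all the moments below exist and $$\big|E_{\mathbb Q}[(I_T-E_{\mathbb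 Q}[I_T])^N]\big|\le\frac{aT}{\lambda b^{N+1}}\,f_N\Big(a,\frac1\lambda,\frac1b,T\Big),$$ and, for all $\rho\le0$, $$G_N\le\frac{a\lambda T|\rho|}{b^N}\,g_N\Big(a,\lambda,\frac1b,T,|\rho|,e^{-\lambda T\kappa(\rho)}\Big).$$ Moreover $\kappa^{(i)}(0)=\varphi_i\,a/b^{2i-1}$ for all integers $i\ge1$, where $\varphi_1=1$ and $\varphi_i=(2i-3)\varphi_{i-1}+(2i-3)!!$ for $i\ge2$. -/

import Mathlib

open MeasureTheory ProbabilityTheory Filter Topology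
open scoped NNReal ENNReal Nat

namespace BNS

/-- A subordinator: a real Lévy process (started at `0`, with independent and stationary
increments) whose paths are almost surely nondecreasing and right-continuous; left limits then
exist by monotonicity. -/
structure IsSubordinator {Ω : Type*} [MeasurableSpace Ω] (P : Measure Ω)
    (Z : ℝ≥0 → Ω → ℝ) : Prop where
  measurable : ∀ t, Measurable (Z t)
  start : ∀ᵐ ω ∂P, Z 0 ω = 0
  indep_increments : HasIndepIncrements Z P
  stationary_increments : ∀ s h, IdentDistrib (fun ω => Z (s + h) ω - Z s ω) (Z h) P P
  monotone_paths : ∀ᵐ ω ∂P, Monotone (fun t => Z t ω)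
  rightContinuous_paths : ∀ᵐ ω ∂P, ∀ t, ContinuousWithinAt (fun s => Z s ω) (Set.Ici t) t

/-- The integrated process `I_t = ∫₀ᵗ V_s ds`, where `V` is indexed by the nonnegative reals. -/
noncomputable def integrated {Ω : Type*} (V : ℝ≥0 → Ω → ℝ) (t : ℝ≥0) (ω : Ω) : ℝ :=
  ∫ s in (0 : ℝ)..t, V s.toNNReal ω

/-- `V` solves `dV_t = -lam V_t dt + dZ_{lam t}` with initial value `V₀`, that is, almost surely,
`V_t = V₀ - lam ∫₀ᵗ V_s ds + Z_{lam t}` for all `t ≥ 0`, the integrals being proper ones. -/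
def IsOUProcess {Ω : Type*} [MeasurableSpace Ω] (P : Measure Ω) (lam : ℝ≥0)
    (Z V : ℝ≥0 → Ω → ℝ) (V₀ : Ω → ℝ) : Prop :=
  ∀ᵐ ω ∂P, ∀ t : ℝ≥0,
    IntervalIntegrable (fun s : ℝ => V s.toNNReal ω) volume 0 t ∧
    V t ω = V₀ ω - lam * integrated V t ω + Z (lam * t) ω

/-- `D` is a stationary distribution of the Ornstein-Uhlenbeck dynamics
`dY_t = -lam Y_t dt + dZ_{lam t}`: the solution whose initial value has law `D` and is independent
of `Z` has law `D` at all times. The independent initial value is the first coordinate of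
`ℝ × Ω` under the product measure. -/
def IsStationaryLaw {Ω : Type*} [MeasurableSpace Ω] (P : Measure Ω) (lam : ℝ≥0)
    (Z : ℝ≥0 → Ω → ℝ) (D : Measure ℝ) : Prop :=
  ∃ Y : ℝ≥0 → ℝ × Ω → ℝ,
    IsOUProcess (D.prod P) lam (fun t p => Z t p.2) Y (fun p => p.1) ∧
    ∀ t, (D.prod P).map (Y t) = D

/-- The density on `(0, ∞)` of the inverse Gaussian distribution with parameters `a, b > 0`. -/
noncomputable def inverseGaussianPDF (a b x : ℝ) : ℝ :=
  if 0 < x then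
    a / √(2 * Real.pi) * Real.exp (a * b) * x ^ (-(3 / 2) : ℝ) *
      Real.exp (-(a ^ 2 / x + b ^ 2 * x) / 2)
  else 0

/-- The inverse Gaussian distribution `IG(a, b)`. -/
noncomputable def inverseGaussian (a b : ℝ) : Measure ℝ :=
  volume.withDensity (fun x => ENNReal.ofReal (inverseGaussianPDF a b x))

/-- The squared volatility `V` is an inverse Gaussian Ornstein-Uhlenbeck process with parameters
`a, b`, mean reversion rate `lam`, background driving subordinator `Z` and deterministic initial
value `v₀`: it is an Ornstein-Uhlenbeck process driven by `Z_{lam t}`, and the stationary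
distribution of these dynamics is `IG(a, b)`. -/
structure IsInverseGaussianOU {Ω : Type*} [MeasurableSpace Ω] (P : Measure Ω) (lam : ℝ≥0)
    (a b v₀ : ℝ) (Z V : ℝ≥0 → Ω → ℝ) : Prop where
  subordinator : IsSubordinator P Z
  isOU : IsOUProcess P lam Z V (fun _ => v₀)
  stationary : IsStationaryLaw P lam Z (inverseGaussian a b)

/-- The cumulant generating function `κ(θ) = log E[exp(θ Z₁)]` of `Z₁`. -/
noncomputable def kappa {Ω : Type*} [MeasurableSpace Ω] (P : Measure Ω)
    (Z : ℝ≥0 → Ω → ℝ) (θ : ℝ) : ℝ :=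
  cgf (Z 1) P θ

/-- The random variable
`-lam T κ(ρ) (exp(-lam T κ(ρ)) / 2 + 1 / 2) + |ρ| Z_{lam T}`. -/
noncomputable def boundVariable {Ω : Type*} [MeasurableSpace Ω] (P : Measure Ω)
    (Z : ℝ≥0 → Ω → ℝ) (lam T : ℝ≥0) (ρ : ℝ) (ω : Ω) : ℝ :=
  -(lam * T * kappa P Z ρ) * (1 / 2 * Real.exp (-(lam * T * kappa P Z ρ)) + 1 / 2)
    + |ρ| * Z (lam * T) ω

/-- `G_N`, the `N`-th moment of `boundVariable`. -/
noncomputable def G {Ω : Type*} [MeasurableSpace Ω] (P : Measure Ω)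
    (Z : ℝ≥0 → Ω → ℝ) (lam T : ℝ≥0) (ρ : ℝ) (N : ℕ) : ℝ :=
  ∫ ω, boundVariable P Z lam T ρ ω ^ N ∂P

/-- `φ₁ = 1` and `φ_n = (2n - 3) φ_{n-1} + (2n - 3)!!` for `n ≥ 2`; the value at `0` is unused. -/
def phi : ℕ → ℕ
  | 0 => 0
  | 1 => 1
  | n + 2 => (2 * n + 1) * phi (n + 1) + (2 * n + 1)‼

end BNS

/-! Both bounds are statements about cumulants. From `M' = K' M`, with `M` the moment generating
function and `K = log M`, Leibniz's rule gives `E[X^(n+1)] = ∑ (n choose j) K^(j+1)(0) E[X^(n-j)]`.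
Hence nonnegative cumulants bounded by `s * d^(j+1) * r j` force `E[X^n] ≤ d^n * momentSeq s r n`,
and for `n ≥ 1` the recursion has a factor `s`. The powers of `d` and this `s` make up the
prefactors in the theorem; what remains is a polynomial built with sums and products from
nonnegative data.

The cumulants of `Z 1` come from stationarity. A solution satisfies `exp (-h) (Y₀ + Z_h) ≤ Y_t ≤ exp
(-h) Y₀ + Z_h` with `h = lam t`. If `Y₀` is independent of `Z` and `Y₀`, `Y_t` both have law `IG(a,
b)`, whose log-Laplace transform is `ab - a √(b² - 2θ)`, then dividing by `h → 0` squeezes `κ(θ) = a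
θ / √(b² - 2θ)` for small `θ > 0`. Analyticity extends this to a neighbourhood of `0`, where the
derivatives are explicit.

Finally, `I_T` is a constant plus `∫₀ᵀ exp (-lam (T - s)) Z_{lam s} ds`, a limit of combinations of
independent increments with weights in `[0, 1/lam]`. Centring removes the constant and the first
cumulant; the others are at most `lam T (1/lam)^k κ^(k)(0)`. Dominated convergence passes to the
limit. The variable in `G_N` is a constant plus `|ρ| Z_{lam T}`, and Jensen's inequality `-κ(ρ) ≤
|ρ| a / b` controls the constant. -/

namespace BNS

/-! ### Moments from cumulants -/

section Moments

/-- The moment sequence whose cumulants are `κ (j + 1) = s * r j`. -/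
def momentSeq {R : Type*} [CommSemiring R] (s : R) (r : ℕ → R) : ℕ → R
  | 0 => 1
  | n + 1 => s * ∑ j : Fin (n + 1), (n.choose j : R) * r j * momentSeq s r (n - j)

lemma momentSeq_succ {R : Type*} [CommSemiring R] (s : R) (r : ℕ → R) (n : ℕ) :
    momentSeq s r (n + 1) =
      s * ∑ j ∈ Finset.range (n + 1), (n.choose j : R) * r j * momentSeq s r (n - j) := by
  rw [momentSeq, Finset.sum_range]

/-- The recursion uses semiring operations only, so it can be run on polynomials over `ℝ≥0` and
evaluated afterwards. -/
lemma map_momentSeq {R S : Type*} [CommSemiring R] [CommSemiring S] (f : R →+* S) (s : R)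
    (r : ℕ → R) (n : ℕ) :
    f (momentSeq s r n) = momentSeq (f s) (fun j => f (r j)) n := by
  induction n using Nat.strong_induction_on with
  | _ n ih =>
    cases n with
    | zero => simp [momentSeq]
    | succ n =>
      simp only [momentSeq_succ, map_mul, map_sum, map_natCast]
      congr 1
      exact Finset.sum_congr rfl fun j _ => by rw [ih (n - j) (by omega)]

variable {Ω : Type*} [MeasurableSpace Ω] {μ : Measure Ω} [IsProbabilityMeasure μ] {X : Ω → ℝ}

lemma integral_pow_succ_eq_sum_cumulants (h : 0 ∈ interior (integrableExpSet X μ)) (n : ℕ) :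
    ∫ ω, X ω ^ (n + 1) ∂μ = ∑ j ∈ Finset.range (n + 1),
      (n.choose j : ℝ) * iteratedDeriv (j + 1) (cgf X μ) 0 * ∫ ω, X ω ^ (n - j) ∂μ := by
  have hm : ∀ k, ∫ ω, X ω ^ k ∂μ = iteratedDeriv k (mgf X μ) 0 := fun k => by
    rw [iteratedDeriv_mgf_zero h]; rfl
  have hev : deriv (mgf X μ) =ᶠ[𝓝 0] deriv (cgf X μ) * mgf X μ := by
    filter_upwards [isOpen_interior.mem_nhds h] with t ht
    have hpos : mgf X μ t ≠ 0 := (mgf_pos (interior_subset (s := integrableExpSet X μ) ht)).ne'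
    rw [Pi.mul_apply, deriv_cgf ht, deriv_mgf ht, div_mul_cancel₀ _ hpos]
  rw [hm, iteratedDeriv_succ', hev.iteratedDeriv_eq, iteratedDeriv_mul
    (analyticAt_cgf h).deriv.contDiffAt (analyticAt_mgf h).contDiffAt]
  exact Finset.sum_congr rfl fun j _ => by rw [hm, ← iteratedDeriv_succ']

/-- Nonnegativity is carried through the induction because the recursion is bounded term by term, as
a product of bounds. -/
lemma integral_pow_mem_Icc_of_cumulants (h : 0 ∈ interior (integrableExpSet X μ)) {s d : ℝ}
    {r : ℕ → ℝ} (h0 : ∀ j, 0 ≤ iteratedDeriv (j + 1) (cgf X μ) 0)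
    (h1 : ∀ j, iteratedDeriv (j + 1) (cgf X μ) 0 ≤ s * d ^ (j + 1) * r j) (n : ℕ) :
    0 ≤ ∫ ω, X ω ^ n ∂μ ∧ ∫ ω, X ω ^ n ∂μ ≤ d ^ n * momentSeq s r n := by
  induction n using Nat.strong_induction_on with
  | _ n ih =>
    cases n with
    | zero => simp [momentSeq]
    | succ n =>
      rw [integral_pow_succ_eq_sum_cumulants h, momentSeq_succ]
      constructor
      · exact Finset.sum_nonneg fun j _ =>
          mul_nonneg (mul_nonneg (Nat.cast_nonneg _) (h0 j)) (ih (n - j) (by omega)).1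
      · rw [Finset.mul_sum, Finset.mul_sum]
        refine Finset.sum_le_sum fun j hj => ?_
        have hj' : j ≤ n := by simpa [Nat.lt_succ_iff] using hj
        obtain ⟨i1, i2⟩ := ih (n - j) (by omega)
        calc (n.choose j : ℝ) * iteratedDeriv (j + 1) (cgf X μ) 0 * ∫ ω, X ω ^ (n - j) ∂μ
            ≤ (n.choose j : ℝ) * (s * d ^ (j + 1) * r j) * (d ^ (n - j) * momentSeq s r (n - j)) :=
              mul_le_mul (mul_le_mul_of_nonneg_left (h1 j) (Nat.cast_nonneg _)) i2 i1
                (mul_nonneg (Nat.cast_nonneg _) ((h0 j).trans (h1 j)))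
          _ = d ^ (n + 1) * (s * ((n.choose j : ℝ) * r j * momentSeq s r (n - j))) := by
              have : d ^ (n + 1) = d ^ (j + 1) * d ^ (n - j) := by
                rw [← pow_add]; congr 1; omega
              rw [this]; ring

end Moments

/-! ### The Laplace transform of the inverse Gaussian law -/

section InverseGaussian

lemma integrable_exp_neg_sq_half : Integrable (fun s : ℝ => Real.exp (-(1 / 2) * s ^ 2)) :=
  integrable_exp_neg_mul_sq (by norm_num)

lemma hasDerivAt_integral_exp_neg_sq_half (u : ℝ) :
    HasDerivAt (fun u : ℝ => ∫ s in (0 : ℝ)..u, Real.exp (-(1 / 2) * s ^ 2))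
      (Real.exp (-(1 / 2) * u ^ 2)) u :=
  intervalIntegral.integral_hasDerivAt_right (by
    exact (Continuous.intervalIntegrable (by fun_prop) _ _))
    (by exact (Continuous.stronglyMeasurableAtFilter (by fun_prop) _ _))
    (by fun_prop)

lemma tendsto_integral_exp_neg_sq_half_atTop :
    Tendsto (fun u : ℝ => ∫ s in (0 : ℝ)..u, Real.exp (-(1 / 2) * s ^ 2)) atTop
      (𝓝 (√(2 * Real.pi) / 2)) := by
  have h := intervalIntegral_tendsto_integral_Ioi 0
    (integrable_exp_neg_sq_half.integrableOn (s := Set.Ioi 0)) tendsto_id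
  rw [integral_gaussian_Ioi, show Real.pi / (1 / 2) = 2 * Real.pi by ring] at h
  exact h

lemma tendsto_integral_exp_neg_sq_half_atBot :
    Tendsto (fun u : ℝ => ∫ s in (0 : ℝ)..u, Real.exp (-(1 / 2) * s ^ 2)) atBot
      (𝓝 (-(√(2 * Real.pi) / 2))) := by
  have h := (tendsto_integral_exp_neg_sq_half_atTop.comp tendsto_neg_atBot_atTop).neg
  refine h.congr fun u => ?_
  have := intervalIntegral.integral_comp_neg (a := 0) (b := u)
    (fun s : ℝ => Real.exp (-(1 / 2) * s ^ 2))
  simp only [even_two, Even.neg_pow, neg_zero] at this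
  simp only [Function.comp_apply]
  rw [this, intervalIntegral.integral_symm, neg_neg]

/-- There is an explicit primitive `F`. Since `(c√x ∓ a/√x)² = c² x + a²/x ∓ 2ac`, both Gaussian
terms of its derivative reduce to the same exponential, and the difference of the inner derivatives
is `a x^(-3/2)`. The integral is the difference `l - l₀` of the limits of `F` at `∞` and `0`. -/
lemma integral_inverseGaussian_kernel {a c : ℝ} (ha : 0 < a) (hc : 0 < c) :
    IntegrableOn (fun x : ℝ => a * x ^ (-(3 / 2) : ℝ) * Real.exp (-(a ^ 2 / x + c ^ 2 * x) / 2))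
      (Set.Ioi 0) ∧
    ∫ x in Set.Ioi (0 : ℝ), a * x ^ (-(3 / 2) : ℝ) * Real.exp (-(a ^ 2 / x + c ^ 2 * x) / 2) =
      √(2 * Real.pi) * Real.exp (-(a * c)) := by
  set G : ℝ → ℝ := fun u => ∫ s in (0 : ℝ)..u, Real.exp (-(1 / 2) * s ^ 2) with hG
  set F : ℝ → ℝ := fun x => Real.exp (-(a * c)) * G (c * √x - a / √x) -
    Real.exp (a * c) * G (c * √x + a / √x) with hF
  set p := √(2 * Real.pi) / 2 with hp
  set l₀ := Real.exp (-(a * c)) * (-p) - Real.exp (a * c) * p with hl₀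
  set l := Real.exp (-(a * c)) * p - Real.exp (a * c) * p with hl
  have hsq : Tendsto (fun x : ℝ => √x) (𝓝[>] 0) (𝓝[>] 0) := by
    refine tendsto_nhdsWithin_iff.2 ⟨?_, ?_⟩
    · have := (Real.continuous_sqrt.tendsto 0).mono_left (nhdsWithin_le_nhds (s := Set.Ioi 0))
      simpa using this
    · filter_upwards [self_mem_nhdsWithin] with x hx using Real.sqrt_pos.2 hx
  have hinv : Tendsto (fun x : ℝ => a / √x) (𝓝[>] 0) atTop := by
    simp only [div_eq_mul_inv]
    exact (tendsto_inv_nhdsGT_zero.comp hsq).const_mul_atTop ha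
  have hlin : Tendsto (fun x : ℝ => c * √x) (𝓝[>] 0) (𝓝 (c * 0)) :=
    (hsq.mono_right nhdsWithin_le_nhds).const_mul c
  have hF0 : Tendsto F (𝓝[>] 0) (𝓝 l₀) := by
    refine ((tendsto_integral_exp_neg_sq_half_atBot.comp ?_).const_mul _).sub
      ((tendsto_integral_exp_neg_sq_half_atTop.comp ?_).const_mul _)
    · simp only [sub_eq_add_neg]
      exact hlin.add_atBot (tendsto_neg_atTop_atBot.comp hinv)
    · exact hlin.add_atTop hinv
  have hsqt : Tendsto (fun x : ℝ => √x) atTop atTop := Real.tendsto_sqrt_atTop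
  have hinvt : Tendsto (fun x : ℝ => a / √x) atTop (𝓝 0) := hsqt.const_div_atTop a
  have hlint : Tendsto (fun x : ℝ => c * √x) atTop atTop := hsqt.const_mul_atTop hc
  have hFt : Tendsto F atTop (𝓝 l) := by
    refine ((tendsto_integral_exp_neg_sq_half_atTop.comp ?_).const_mul _).sub
      ((tendsto_integral_exp_neg_sq_half_atTop.comp ?_).const_mul _)
    · simp only [sub_eq_add_neg]
      exact hlint.atTop_add (by simpa using hinvt.neg)
    · exact hlint.atTop_add hinvt
  have hderiv : ∀ x ∈ Set.Ioi (0 : ℝ), HasDerivAt F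
      (a * x ^ (-(3 / 2) : ℝ) * Real.exp (-(a ^ 2 / x + c ^ 2 * x) / 2)) x := by
    intro x hx
    have hx0 : (0 : ℝ) < x := hx
    have hs : 0 < √x := Real.sqrt_pos.2 hx0
    have hs2 : √x ^ 2 = x := Real.sq_sqrt hx0.le
    have d1 : HasDerivAt (fun x : ℝ => √x) (1 / (2 * √x)) x := Real.hasDerivAt_sqrt hx0.ne'
    have d2 : HasDerivAt (fun x : ℝ => a / √x) (-(a * (1 / (2 * √x))) / √x ^ 2) x := by
      have := (hasDerivAt_const x a).div d1 hs.ne'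
      simp only [zero_mul, zero_sub] at this
      exact this
    have d3 := (hasDerivAt_integral_exp_neg_sq_half (c * √x - a / √x)).comp x
      ((d1.const_mul c).sub d2)
    have d4 := (hasDerivAt_integral_exp_neg_sq_half (c * √x + a / √x)).comp x
      ((d1.const_mul c).add d2)
    refine ((d3.const_mul (Real.exp (-(a * c)))).sub (d4.const_mul (Real.exp (a * c)))).congr_deriv ?_
    have e1 : Real.exp (-(1 / 2) * (c * √x - a / √x) ^ 2) =
        Real.exp (a * c) * Real.exp (-(a ^ 2 / x + c ^ 2 * x) / 2) := by
      rw [← Real.exp_add]; congr 1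
      nth_rw 3 4 [← hs2]
      field_simp; ring
    have e2 : Real.exp (-(1 / 2) * (c * √x + a / √x) ^ 2) =
        Real.exp (-(a * c)) * Real.exp (-(a ^ 2 / x + c ^ 2 * x) / 2) := by
      rw [← Real.exp_add]; congr 1
      nth_rw 3 4 [← hs2]
      field_simp; ring
    have e3 : Real.exp (-(a * c)) * Real.exp (a * c) = 1 := by rw [← Real.exp_add]; simp
    have e4 : x ^ (-(3 / 2) : ℝ) = 1 / √x ^ 3 := by
      rw [Real.rpow_neg hx0.le, Real.sqrt_eq_rpow, ← Real.rpow_natCast, ← Real.rpow_mul hx0.le,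
        one_div]
      norm_num
    rw [e1, e2, e4]
    generalize Real.exp (-(a ^ 2 / x + c ^ 2 * x) / 2) = E
    have : ∀ A B : ℝ, Real.exp (-(a * c)) * (Real.exp (a * c) * E * A) -
        Real.exp (a * c) * (Real.exp (-(a * c)) * E * B) = E * (A - B) := fun A B => by
      linear_combination (E * A - E * B) * e3
    rw [this]
    field_simp
    ring
  -- The limit at `0` is inserted as a value, which makes the primitive continuous on the closed
  -- half-line.
  set F' : ℝ → ℝ := fun x => if 0 < x then F x else l₀ with hF'
  have hcont : ContinuousWithinAt F' (Set.Ici 0) 0 := by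
    rw [← continuousWithinAt_Ioi_iff_Ici]
    refine Tendsto.congr' ?_ (by simpa [ContinuousWithinAt, hF'] using hF0)
    filter_upwards [self_mem_nhdsWithin] with x hx
    simp only [hF', if_pos (show (0 : ℝ) < x from hx)]
  have hderiv' : ∀ x ∈ Set.Ioi (0 : ℝ), HasDerivAt F'
      (a * x ^ (-(3 / 2) : ℝ) * Real.exp (-(a ^ 2 / x + c ^ 2 * x) / 2)) x := by
    intro x hx
    refine (hderiv x hx).congr_of_eventuallyEq ?_
    filter_upwards [lt_mem_nhds (show (0 : ℝ) < x from hx)] with y hy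
    simp only [hF', if_pos hy]
  have hFt' : Tendsto F' atTop (𝓝 l) := by
    refine hFt.congr' ?_
    filter_upwards [eventually_gt_atTop 0] with y hy
    simp only [hF', if_pos hy]
  have hnn : ∀ x ∈ Set.Ioi (0 : ℝ),
      0 ≤ a * x ^ (-(3 / 2) : ℝ) * Real.exp (-(a ^ 2 / x + c ^ 2 * x) / 2) := fun x hx =>
    mul_nonneg (mul_nonneg ha.le (Real.rpow_nonneg (le_of_lt hx) _)) (Real.exp_nonneg _)
  refine ⟨integrableOn_Ioi_deriv_of_nonneg hcont hderiv' hnn hFt', ?_⟩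
  rw [integral_Ioi_of_hasDerivAt_of_nonneg hcont hderiv' hnn hFt']
  simp only [hF', lt_irrefl, if_false, hl, hl₀, hp]
  ring

lemma measurable_inverseGaussianPDF (a b : ℝ) : Measurable (inverseGaussianPDF a b) := by
  unfold inverseGaussianPDF
  refine Measurable.ite measurableSet_Ioi ?_ measurable_const
  fun_prop

/-- Tilting by `exp (θ x)` only replaces `b` by `c = √(b² - 2θ)` in the exponential factor of the
density. -/
lemma lintegral_exp_inverseGaussian {a b θ : ℝ} (ha : 0 < a) (hθ : 0 < b ^ 2 - 2 * θ) :
    ∫⁻ x, ENNReal.ofReal (Real.exp (θ * x)) ∂(inverseGaussian a b) =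
      ENNReal.ofReal (Real.exp (a * b - a * √(b ^ 2 - 2 * θ))) := by
  set c := √(b ^ 2 - 2 * θ) with hc
  have hc0 : 0 < c := Real.sqrt_pos.2 hθ
  have hc2 : c ^ 2 = b ^ 2 - 2 * θ := Real.sq_sqrt hθ.le
  obtain ⟨hint, hval⟩ := integral_inverseGaussian_kernel ha hc0
  rw [inverseGaussian, lintegral_withDensity_eq_lintegral_mul _
    (measurable_inverseGaussianPDF a b).ennreal_ofReal (by fun_prop)]
  have hpi : 0 < √(2 * Real.pi) := Real.sqrt_pos.2 (by positivity)
  have heq : (fun x => ((fun x => ENNReal.ofReal (inverseGaussianPDF a b x)) *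
      fun x => ENNReal.ofReal (Real.exp (θ * x))) x) =
      (Set.Ioi (0 : ℝ)).indicator fun x => ENNReal.ofReal (Real.exp (a * b) / √(2 * Real.pi) *
        (a * x ^ (-(3 / 2) : ℝ) * Real.exp (-(a ^ 2 / x + c ^ 2 * x) / 2))) := by
    funext x
    by_cases hx : 0 < x
    · rw [Set.indicator_of_mem (Set.mem_Ioi.2 hx), Pi.mul_apply,
        ← ENNReal.ofReal_mul' (Real.exp_nonneg _)]
      congr 1
      have : Real.exp (-(a ^ 2 / x + c ^ 2 * x) / 2) =
          Real.exp (-(a ^ 2 / x + b ^ 2 * x) / 2) * Real.exp (θ * x) := by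
        rw [← Real.exp_add, hc2]; congr 1; ring
      rw [inverseGaussianPDF, if_pos hx, this]
      ring
    · rw [Set.indicator_of_notMem (by simpa using hx)]
      simp [inverseGaussianPDF, hx]
  rw [heq, lintegral_indicator measurableSet_Ioi, ← ofReal_integral_eq_lintegral_ofReal,
    integral_const_mul, hval]
  · congr 1
    rw [sub_eq_add_neg, Real.exp_add]
    field_simp
  · exact hint.const_mul _
  · filter_upwards [ae_restrict_mem measurableSet_Ioi] with x hx
    have : (0 : ℝ) < x := hx
    positivity

lemma isProbabilityMeasure_inverseGaussian {a b : ℝ} (ha : 0 < a) (hb : 0 < b) :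
    IsProbabilityMeasure (inverseGaussian a b) := by
  constructor
  have := lintegral_exp_inverseGaussian (b := b) (θ := 0) ha (by simpa using pow_pos hb 2)
  simpa [Real.sqrt_sq hb.le] using this

end InverseGaussian

/-! ### Pathwise analysis of the Ornstein-Uhlenbeck equation -/

section Paths

lemma integral_exp_neg_mul_sub {lam : ℝ} (hlam : lam ≠ 0) (t : ℝ) :
    ∫ s in (0 : ℝ)..t, Real.exp (-lam * (t - s)) = (1 - Real.exp (-lam * t)) / lam := by
  have hd : ∀ x ∈ Set.uIcc (0 : ℝ) t, HasDerivAt (fun s => Real.exp (-lam * (t - s)) / lam)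
      (Real.exp (-lam * (t - x))) x := fun x _ => by
    have h1 : HasDerivAt (fun s : ℝ => -lam * (t - s)) lam x := by
      simpa using ((hasDerivAt_id x).const_sub t).const_mul (-lam)
    convert! h1.exp.div_const lam using 1
    field_simp
  rw [intervalIntegral.integral_eq_sub_of_hasDerivAt hd
    (Continuous.intervalIntegrable (by fun_prop) _ _)]
  simp only [sub_self, mul_zero, Real.exp_zero, sub_zero]
  ring

lemma monotone_comp_toNNReal {z : ℝ≥0 → ℝ} (hz : Monotone z) :
    Monotone fun s : ℝ => z s.toNNReal :=
  fun _ _ h => hz (Real.toNNReal_mono h)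

lemma intervalIntegrable_exp_mul_monotone {z : ℝ≥0 → ℝ} (hz : Monotone z) (lam t x y : ℝ) :
    IntervalIntegrable (fun s : ℝ => Real.exp (-lam * (t - s)) * z s.toNNReal) volume x y :=
  ((monotone_comp_toNNReal hz).intervalIntegrable).continuousOn_mul
    (Continuous.continuousOn (by fun_prop))

/-- The variation of constants formula for the primitive of an Ornstein-Uhlenbeck path. -/
lemma integral_eq_of_ou_equation {v z : ℝ≥0 → ℝ} {lam v₀ : ℝ} (hz : Monotone z)
    (hzr : ∀ t, ContinuousWithinAt z (Set.Ici t) t)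
    (hv : ∀ t : ℝ≥0, IntervalIntegrable (fun s : ℝ => v s.toNNReal) volume 0 t ∧
      v t = v₀ - lam * (∫ s in (0 : ℝ)..t, v s.toNNReal) + z t) (t : ℝ≥0) :
    ∫ s in (0 : ℝ)..t, v s.toNNReal =
      ∫ s in (0 : ℝ)..t, Real.exp (-lam * (t - s)) * (v₀ + z s.toNNReal) := by
  set J : ℝ → ℝ := fun x => ∫ s in (0 : ℝ)..x, v s.toNNReal with hJ
  have hvi : ∀ x : ℝ, 0 ≤ x → IntervalIntegrable (fun s : ℝ => v s.toNNReal) volume 0 x :=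
    fun x hx => by simpa [hx] using (hv x.toNNReal).1
  have hve : ∀ x : ℝ, 0 ≤ x → v x.toNNReal = v₀ - lam * J x + z x.toNNReal :=
    fun x hx => by simpa [hx] using (hv x.toNNReal).2
  have hJc : ∀ x : ℝ, 0 ≤ x → ContinuousOn J (Set.Icc 0 x) := fun x hx => by
    have := intervalIntegral.continuousOn_primitive_interval' (hvi x hx) Set.left_mem_uIcc
    rwa [Set.uIcc_of_le hx] at this
  have hzc : ∀ x : ℝ, 0 ≤ x → ContinuousWithinAt (fun s : ℝ => z s.toNNReal) (Set.Ioi x) x :=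
    fun x _ => (hzr x.toNNReal).comp continuous_real_toNNReal.continuousWithinAt
      fun s hs => Real.toNNReal_mono (le_of_lt hs)
  -- Only a right derivative is available: `v` inherits right-continuity from `z` and may jump.
  have hJr : ∀ x ∈ Set.Ioo (0 : ℝ) t, HasDerivWithinAt J (v x.toNNReal) (Set.Ioi x) x := by
    intro x hx
    have hcont : ContinuousWithinAt (fun s : ℝ => v s.toNNReal) (Set.Ioi x) x := by
      have hJx : ContinuousWithinAt J (Set.Ioi x) x :=
        ((hJc (x + 1) (by linarith [hx.1])).continuousAt
          (Icc_mem_nhds hx.1 (by linarith))).continuousWithinAt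
      refine ((continuousWithinAt_const.sub (continuousWithinAt_const.mul hJx)).add
        (hzc x hx.1.le)).congr (fun y hy => hve y (hx.1.le.trans (le_of_lt hy))) (hve x hx.1.le)
    refine (intervalIntegral.integral_hasDerivWithinAt_right (s := Set.Ici x) (t := Set.Ioi x)
      (hvi x hx.1.le) ⟨Set.Ioc x (x + 1), Ioc_mem_nhdsGT (by linarith), ?_⟩ hcont).mono
      Set.Ioi_subset_Ici_self
    have := (hvi (x + 1) (by linarith [hx.1])).1.aestronglyMeasurable
    exact this.mono_set (Set.Ioc_subset_Ioc_left hx.1.le)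
  -- Integrating factor: `exp (lam x) J x` has right derivative `exp (lam x) (v₀ + z x)`.
  have key := intervalIntegral.integral_eq_sub_of_hasDeriv_right_of_le
    (f := fun x => Real.exp (lam * x) * J x)
    (f' := fun x => Real.exp (lam * x) * (v₀ + z x.toNNReal)) (a := 0) (b := t) t.2
    ((Continuous.continuousOn (by fun_prop)).mul (hJc t t.2)) ?_ ?_
  · have h0 : J 0 = 0 := by simp [hJ]
    rw [h0, mul_zero, sub_zero] at key
    have : ∫ s in (0 : ℝ)..t, Real.exp (-lam * (t - s)) * (v₀ + z s.toNNReal) =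
        Real.exp (-lam * t) * (Real.exp (lam * t) * J t) := by
      rw [← key, ← intervalIntegral.integral_const_mul]
      refine intervalIntegral.integral_congr fun s _ => ?_
      rw [← mul_assoc, ← Real.exp_add]
      congr 2; ring
    rw [this, ← mul_assoc, ← Real.exp_add]
    simp [hJ]
  · intro x hx
    have h1 : HasDerivAt (fun x : ℝ => Real.exp (lam * x)) (Real.exp (lam * x) * lam) x := by
      simpa using ((hasDerivAt_id x).const_mul lam).exp
    refine (h1.hasDerivWithinAt.mul (hJr x hx)).congr_deriv ?_
    rw [hve x hx.1.le]; ring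
  · exact (intervalIntegrable_const.add (monotone_comp_toNNReal hz).intervalIntegrable).continuousOn_mul
      (Continuous.continuousOn (by fun_prop))

lemma integral_ou_split {z : ℝ≥0 → ℝ} (hz : Monotone z) {lam : ℝ} (hlam : lam ≠ 0) (v₀ t : ℝ) :
    ∫ s in (0 : ℝ)..t, Real.exp (-lam * (t - s)) * (v₀ + z s.toNNReal) =
      (1 - Real.exp (-lam * t)) / lam * v₀ +
        ∫ s in (0 : ℝ)..t, Real.exp (-lam * (t - s)) * z s.toNNReal := by
  simp only [mul_add]
  rw [intervalIntegral.integral_add (Continuous.intervalIntegrable (by fun_prop) _ _)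
    (intervalIntegrable_exp_mul_monotone hz lam t 0 t), intervalIntegral.integral_mul_const,
    integral_exp_neg_mul_sub hlam]

/-- By variation of constants `v t = exp (-lam t) v₀ + z t - lam W`, and `0 ≤ z s ≤ z t` gives `0 ≤
lam W ≤ (1 - exp (-lam t)) z t`. -/
lemma ou_equation_bounds {v z : ℝ≥0 → ℝ} {lam v₀ : ℝ} (hlam : 0 < lam) (hz : Monotone z)
    (hz0 : z 0 = 0) (hzr : ∀ t, ContinuousWithinAt z (Set.Ici t) t)
    (hv : ∀ t : ℝ≥0, IntervalIntegrable (fun s : ℝ => v s.toNNReal) volume 0 t ∧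
      v t = v₀ - lam * (∫ s in (0 : ℝ)..t, v s.toNNReal) + z t) (t : ℝ≥0) :
    Real.exp (-lam * t) * v₀ + Real.exp (-lam * t) * z t ≤ v t ∧
      v t ≤ Real.exp (-lam * t) * v₀ + z t := by
  have hnn : ∀ s, 0 ≤ z s := fun s => hz0 ▸ hz (zero_le (a := s))
  rw [(hv t).2, integral_eq_of_ou_equation hz hzr hv t, integral_ou_split hz hlam.ne']
  set W := ∫ s in (0 : ℝ)..t, Real.exp (-lam * (t - s)) * z s.toNNReal
  have hW0 : 0 ≤ W := intervalIntegral.integral_nonneg t.2 fun s _ =>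
    mul_nonneg (Real.exp_nonneg _) (hnn _)
  have hW1 : W ≤ (1 - Real.exp (-lam * t)) / lam * z t := by
    rw [← integral_exp_neg_mul_sub hlam.ne', ← intervalIntegral.integral_mul_const]
    refine intervalIntegral.integral_mono_on t.2 (intervalIntegrable_exp_mul_monotone hz lam t 0 t)
      (Continuous.intervalIntegrable (by fun_prop) _ _) fun s hs => ?_
    exact mul_le_mul_of_nonneg_left (hz (Real.toNNReal_le_iff_le_coe.2 hs.2)) (Real.exp_nonneg _)
  have e : lam * ((1 - Real.exp (-lam * t)) / lam * v₀ + W) =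
      (1 - Real.exp (-lam * t)) * v₀ + lam * W := by field_simp
  have hW2 : lam * W ≤ (1 - Real.exp (-lam * t)) * z t := by
    calc lam * W ≤ lam * ((1 - Real.exp (-lam * t)) / lam * z t) :=
          mul_le_mul_of_nonneg_left hW1 hlam.le
      _ = _ := by field_simp
  have hW3 : 0 ≤ lam * W := mul_nonneg hlam.le hW0
  rw [e]
  constructor <;> linarith

/-- Riemann sums for `∫₀ᵗ exp (-lam (t - s)) z_s ds`, written in terms of the increments of `z`. -/
lemma exists_increment_weights {lam : ℝ} (hlam : 0 < lam) (t : ℝ≥0) {n : ℕ} (hn : n ≠ 0) :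
    ∃ c : ℕ → ℝ, (∀ j, 0 ≤ c j ∧ c j ≤ 1 / lam) ∧ ∀ z : ℝ≥0 → ℝ, Monotone z → z 0 = 0 →
      |(∫ s in (0 : ℝ)..t, Real.exp (-lam * (t - s)) * z s.toNNReal) -
        ∑ j ∈ Finset.range n, c j * (z ((j + 1 : ℕ) * (t / n)) - z (j * (t / n)))| ≤
          t / n * z t := by
  set δ : ℝ≥0 := t / n with hδ
  have hnδ : (n : ℝ≥0) * δ = t := by rw [hδ]; field_simp
  set p : ℕ → ℝ := fun k => ((k * δ : ℝ≥0) : ℝ) with hp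
  have hpm : Monotone p := fun i j h => by
    simp only [hp]; gcongr
  have hp0 : p 0 = 0 := by simp [hp]
  have hpn : p n = t := by simp only [hp]; rw [hnδ]
  have hpd : ∀ k, p (k + 1) - p k = δ := fun k => by simp [hp]; ring
  have hE : ∀ x y : ℝ, IntervalIntegrable (fun s : ℝ => Real.exp (-lam * (t - s))) volume x y :=
    fun x y => Continuous.intervalIntegrable (by fun_prop) _ _
  set w : ℕ → ℝ := fun k => ∫ s in p k..p (k + 1), Real.exp (-lam * (t - s)) with hw
  have hw0 : ∀ k, 0 ≤ w k := fun k =>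
    intervalIntegral.integral_nonneg (hpm k.le_succ) fun s _ => Real.exp_nonneg _
  have hw1 : ∀ k ∈ Finset.range n, w k ≤ δ := fun k hk => by
    have hk' : p (k + 1) ≤ t := hpn ▸ hpm (Finset.mem_range.1 hk)
    have : w k ≤ ∫ s in p k..p (k + 1), (1 : ℝ) := by
      refine intervalIntegral.integral_mono_on (hpm k.le_succ) (hE _ _)
        (Continuous.intervalIntegrable (by fun_prop) _ _) fun s hs => ?_
      rw [Real.exp_le_one_iff]
      nlinarith [hs.2]
    simpa [hpd] using this
  have hwsum : ∑ k ∈ Finset.range n, w k ≤ 1 / lam := by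
    rw [hw, intervalIntegral.sum_integral_adjacent_intervals fun k _ => hE _ _, hp0, hpn,
      integral_exp_neg_mul_sub hlam.ne']
    gcongr
    linarith [Real.exp_pos (-lam * t)]
  -- Summation by parts: the increment over cell `j` enters every value `z (k δ)` with `k > j`, so
  -- its weight is the sum of those `w k`.
  refine ⟨fun j => ∑ k ∈ (Finset.range n).filter (j < ·), w k, fun j =>
    ⟨Finset.sum_nonneg fun k _ => hw0 k, (Finset.sum_le_sum_of_subset_of_nonneg
      (Finset.filter_subset _ _) fun k _ _ => hw0 k).trans hwsum⟩, fun z hz hz0 => ?_⟩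
  have hsum : ∑ j ∈ Finset.range n, (∑ k ∈ (Finset.range n).filter (j < ·), w k) *
      (z ((j + 1 : ℕ) * δ) - z (j * δ)) = ∑ k ∈ Finset.range n, w k * z (k * δ) := by
    simp only [Finset.sum_mul]
    rw [Finset.sum_comm' (t' := Finset.range n) (s' := fun k => Finset.range k)]
    · refine Finset.sum_congr rfl fun k _ => ?_
      rw [← Finset.mul_sum, Finset.sum_range_sub fun j : ℕ => z (j * δ)]
      simp [hz0]
    · intro j k
      simp only [Finset.mem_range, Finset.mem_filter]
      constructor <;> intro h <;> omega
  have hW : ∫ s in (0 : ℝ)..t, Real.exp (-lam * (t - s)) * z s.toNNReal =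
      ∑ k ∈ Finset.range n, ∫ s in p k..p (k + 1), Real.exp (-lam * (t - s)) * z s.toNNReal := by
    rw [intervalIntegral.sum_integral_adjacent_intervals
      fun k _ => intervalIntegrable_exp_mul_monotone hz lam t _ _, hp0, hpn]
  have hpiece : ∀ k, w k * z (k * δ) ≤
      ∫ s in p k..p (k + 1), Real.exp (-lam * (t - s)) * z s.toNNReal ∧
      ∫ s in p k..p (k + 1), Real.exp (-lam * (t - s)) * z s.toNNReal ≤
        w k * z ((k + 1 : ℕ) * δ) := fun k => by
    rw [hw]
    simp only [← intervalIntegral.integral_mul_const]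
    constructor
    · refine intervalIntegral.integral_mono_on (hpm k.le_succ) ((hE _ _).mul_const _)
        (intervalIntegrable_exp_mul_monotone hz lam t _ _) fun s hs => ?_
      exact mul_le_mul_of_nonneg_left (hz (NNReal.le_toNNReal_of_coe_le hs.1)) (Real.exp_nonneg _)
    · refine intervalIntegral.integral_mono_on (hpm k.le_succ)
        (intervalIntegrable_exp_mul_monotone hz lam t _ _) ((hE _ _).mul_const _) fun s hs => ?_
      exact mul_le_mul_of_nonneg_left (hz (Real.toNNReal_le_iff_le_coe.2 hs.2)) (Real.exp_nonneg _)
  rw [hsum, hW, ← Finset.sum_sub_distrib, abs_of_nonneg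
    (Finset.sum_nonneg fun k _ => sub_nonneg.2 (hpiece k).1)]
  -- By monotonicity the error on each cell is at most `δ` times the increment of `z`, and the
  -- increments telescope.
  calc ∑ k ∈ Finset.range n, ((∫ s in p k..p (k + 1), Real.exp (-lam * (t - s)) * z s.toNNReal) -
        w k * z (k * δ))
      ≤ ∑ k ∈ Finset.range n, (δ : ℝ) * (z ((k + 1 : ℕ) * δ) - z (k * δ)) := by
        refine Finset.sum_le_sum fun k hk => ?_
        have hinc : 0 ≤ z ((k + 1 : ℕ) * δ) - z (k * δ) :=
          sub_nonneg.2 (hz (by gcongr; exact k.le_succ))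
        have := mul_le_mul_of_nonneg_right (hw1 k hk) hinc
        linarith [(hpiece k).2]
    _ = t / n * z t := by
        rw [← Finset.mul_sum, Finset.sum_range_sub fun j : ℕ => z (j * δ), hnδ]
        simp [hz0, hδ]

end Paths

/-! ### Subordinators: exponential moments are exponential in time -/

/-- Cauchy's equation: a nonnegative additive function is monotone. Sandwiching `n t` between
consecutive integers bounds `n |f t - t f 1|` by `f 1` for every `n`. -/
lemma eq_mul_of_additive_of_nonneg {f : ℝ≥0 → ℝ} (hadd : ∀ s t, f (s + t) = f s + f t)
    (hf : ∀ t, 0 ≤ f t) (t : ℝ≥0) : f t = t * f 1 := by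
  have hmono : Monotone f := fun s u hsu => by
    obtain ⟨d, rfl⟩ := exists_add_of_le hsu
    rw [hadd]; linarith [hf d]
  have hmul : ∀ (n : ℕ) (s : ℝ≥0), f (n * s) = n * f s := fun n s => by
    induction n with
    | zero =>
      have := hadd 0 0
      simp only [add_zero] at this
      simp only [Nat.cast_zero, zero_mul]; linarith
    | succ n ih => push_cast; rw [add_mul, one_mul, hadd, ih]; ring
  have key : ∀ n : ℕ, n * |f t - t * f 1| ≤ f 1 := fun n => by
    set m := ⌊(n : ℝ≥0) * t⌋₊ with hm
    have h1 : (m : ℝ≥0) ≤ n * t := Nat.floor_le (zero_le (a := (n : ℝ≥0) * t))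
    have h2 : (n : ℝ≥0) * t ≤ (m + 1 : ℕ) := by
      push_cast; exact (Nat.lt_floor_add_one _).le
    have f1 := hmono h1
    have f2 := hmono h2
    have e := fun k : ℕ => hmul k 1
    simp only [mul_one] at e
    rw [e, hmul] at f1
    rw [e, hmul] at f2
    have h1' : (m : ℝ) ≤ n * t := by exact_mod_cast h1
    have h2' : (n : ℝ) * t ≤ m + 1 := by exact_mod_cast h2
    push_cast at f2
    rw [← Nat.abs_cast n, ← abs_mul, abs_le]
    have := hf 1
    constructor <;> nlinarith
  by_contra hne
  have hpos : 0 < |f t - t * f 1| := abs_pos.2 (sub_ne_zero.2 hne)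
  obtain ⟨n, hn⟩ := exists_nat_gt (f 1 / |f t - t * f 1|)
  rw [div_lt_iff₀ hpos] at hn
  linarith [key n]

namespace IsSubordinator

variable {Ω : Type*} [MeasurableSpace Ω] {P : Measure Ω}
  {Z : ℝ≥0 → Ω → ℝ} {θ : ℝ}

lemma ae_nonneg (hZ : IsSubordinator P Z) (t : ℝ≥0) : ∀ᵐ ω ∂P, 0 ≤ Z t ω := by
  filter_upwards [hZ.start, hZ.monotone_paths] with ω h0 hm
  exact h0 ▸ hm (zero_le (a := t))

lemma indepFun_increment (hZ : IsSubordinator P Z) (s h : ℝ≥0) :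
    IndepFun (Z s) (Z (s + h) - Z s) P :=
  hZ.indep_increments.indepFun_eval_sub (zero_le (a := s)) le_self_add hZ.start

lemma integrable_exp_add (hZ : IsSubordinator P Z) {s h : ℝ≥0}
    (h1 : Integrable (fun ω => Real.exp (θ * Z s ω)) P)
    (h2 : Integrable (fun ω => Real.exp (θ * Z h ω)) P) :
    Integrable (fun ω => Real.exp (θ * Z (s + h) ω)) P := by
  have h2' : Integrable (fun ω => Real.exp (θ * (Z (s + h) - Z s) ω)) P :=
    ((hZ.stationary_increments s h).comp (u := fun x => Real.exp (θ * x))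
      (by fun_prop)).integrable_iff.2 h2
  have := (hZ.indepFun_increment s h).integrable_exp_mul_add h1 h2'
  simpa using this

variable [IsProbabilityMeasure P]

lemma integrable_exp (hZ : IsSubordinator P Z)
    (h : Integrable (fun ω => Real.exp (θ * Z 1 ω)) P) (t : ℝ≥0) :
    Integrable (fun ω => Real.exp (θ * Z t ω)) P := by
  have hnat : ∀ n : ℕ, Integrable (fun ω => Real.exp (θ * Z n ω)) P := fun n => by
    induction n with
    | zero =>
      refine (integrable_const (1 : ℝ)).congr ?_
      filter_upwards [hZ.start] with ω hω
      simp [hω]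
    | succ n ih => push_cast; exact hZ.integrable_exp_add ih h
  obtain ⟨n, hn⟩ := exists_nat_ge t
  refine ((hnat n).add (integrable_const 1)).mono'
    (((hZ.measurable t).const_mul θ).exp.aestronglyMeasurable) ?_
  filter_upwards [hZ.monotone_paths, hZ.ae_nonneg t] with ω hm h0
  rw [Real.norm_of_nonneg (Real.exp_nonneg _), Pi.add_apply]
  rcases le_total 0 θ with hθ | hθ
  · have := Real.exp_le_exp.2 (mul_le_mul_of_nonneg_left (hm hn) hθ)
    simp only at this
    linarith
  · have := Real.exp_le_one_iff.2 (mul_nonpos_of_nonpos_of_nonneg hθ h0)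
    linarith [Real.exp_pos (θ * Z n ω)]

lemma integrable_exp_of_nonpos (hZ : IsSubordinator P Z) (hθ : θ ≤ 0) (t : ℝ≥0) :
    Integrable (fun ω => Real.exp (θ * Z t ω)) P := by
  refine (integrable_const (1 : ℝ)).mono'
    (((hZ.measurable t).const_mul θ).exp.aestronglyMeasurable) ?_
  filter_upwards [hZ.ae_nonneg t] with ω h0
  rw [Real.norm_of_nonneg (Real.exp_nonneg _)]
  exact Real.exp_le_one_iff.2 (mul_nonpos_of_nonpos_of_nonneg hθ h0)

lemma cgf_add (hZ : IsSubordinator P Z) (h : Integrable (fun ω => Real.exp (θ * Z 1 ω)) P)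
    (s t : ℝ≥0) : cgf (Z (s + t)) P θ = cgf (Z s) P θ + cgf (Z t) P θ := by
  have hs := hZ.stationary_increments s t
  have h2' : Integrable (fun ω => Real.exp (θ * (Z (s + t) - Z s) ω)) P :=
    (hs.comp (u := fun x => Real.exp (θ * x)) (by fun_prop)).integrable_iff.2
      (hZ.integrable_exp h t)
  have h1 := (hZ.indepFun_increment s t).cgf_add (hZ.integrable_exp h s) h2'
  have h3 : cgf (Z (s + t) - Z s) P θ = cgf (Z t) P θ := by
    rw [cgf, cgf]; exact congrArg Real.log (congrFun (mgf_congr_identDistrib hs) θ)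
  rwa [add_sub_cancel, h3] at h1

/-- The function `t ↦ cgf (Z t) P θ` is additive and, as `Z ≥ 0` almost surely, has the sign of `θ`;
Cauchy's equation applies to it or to its negative. -/
lemma cgf_eq (hZ : IsSubordinator P Z) (h : Integrable (fun ω => Real.exp (θ * Z 1 ω)) P)
    (t : ℝ≥0) : cgf (Z t) P θ = t * kappa P Z θ := by
  rcases le_total 0 θ with hθ | hθ
  · refine eq_mul_of_additive_of_nonneg (f := fun t => cgf (Z t) P θ) (hZ.cgf_add h) (fun t => ?_) t
    refine Real.log_nonneg ?_
    calc (1 : ℝ) = ∫ _, (1 : ℝ) ∂P := by simp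
      _ ≤ mgf (Z t) P θ := by
        refine integral_mono_ae (integrable_const _) (hZ.integrable_exp h t) ?_
        filter_upwards [hZ.ae_nonneg t] with ω h0
        exact Real.one_le_exp (mul_nonneg hθ h0)
  · have := eq_mul_of_additive_of_nonneg (f := fun t => -cgf (Z t) P θ)
      (fun s t => by rw [hZ.cgf_add h]; ring) (fun t => ?_) t
    · simp only [mul_neg, neg_inj] at this
      exact this
    refine neg_nonneg.2 (Real.log_nonpos mgf_nonneg ?_)
    calc mgf (Z t) P θ ≤ ∫ _, (1 : ℝ) ∂P := by
          refine integral_mono_ae (hZ.integrable_exp h t) (integrable_const _) ?_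
          filter_upwards [hZ.ae_nonneg t] with ω h0
          exact Real.exp_le_one_iff.2 (mul_nonpos_of_nonpos_of_nonneg hθ h0)
      _ = 1 := by simp

lemma mgf_eq (hZ : IsSubordinator P Z) (h : Integrable (fun ω => Real.exp (θ * Z 1 ω)) P)
    (t : ℝ≥0) : mgf (Z t) P θ = Real.exp (t * kappa P Z θ) := by
  rw [← hZ.cgf_eq h, exp_cgf (hZ.integrable_exp h t)]

/-- Exponential moments and cumulant generating function of a linear combination of increments. -/
lemma cgf_sum_increments (hZ : IsSubordinator P Z) (c : ℕ → ℝ) (δ : ℝ≥0) (n : ℕ)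
    (h : ∀ j, Integrable (fun ω => Real.exp (θ * c j * Z 1 ω)) P) :
    Integrable (fun ω => Real.exp
      (θ * ∑ j ∈ Finset.range n, c j * (Z ((j + 1 : ℕ) * δ) ω - Z (j * δ) ω))) P ∧
    cgf (fun ω => ∑ j ∈ Finset.range n, c j * (Z ((j + 1 : ℕ) * δ) ω - Z (j * δ) ω)) P θ =
      ∑ j ∈ Finset.range n, δ * kappa P Z (c j * θ) := by
  set X : ℕ → Ω → ℝ := fun j ω => c j * (Z ((j + 1 : ℕ) * δ) ω - Z (j * δ) ω) with hX
  have hmono : Monotone fun j : ℕ => (j : ℝ≥0) * δ := fun i j hij => by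
    simp only; gcongr
  have hind : iIndepFun X P :=
    (hZ.indep_increments.nat hmono).comp (fun j x => c j * x) fun j => by fun_prop
  have hmeas : ∀ j, Measurable (X j) := fun j =>
    ((hZ.measurable _).sub (hZ.measurable _)).const_mul _
  have hid : ∀ j : ℕ, IdentDistrib (fun ω => Z ((j + 1 : ℕ) * δ) ω - Z (j * δ) ω) (Z δ) P P :=
    fun j => by
      have := hZ.stationary_increments (j * δ) δ
      rwa [show (j : ℝ≥0) * δ + δ = (j + 1 : ℕ) * δ by push_cast; ring] at this
  have hint : ∀ j, Integrable (fun ω => Real.exp (θ * X j ω)) P := fun j => by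
    have := ((hid j).comp (u := fun x => Real.exp (θ * c j * x)) (by fun_prop)).integrable_iff.2
      (hZ.integrable_exp (h j) δ)
    refine this.congr (Eventually.of_forall fun ω => ?_)
    simp only [hX, Function.comp_apply, mul_assoc]
  have hfun : (fun ω => ∑ j ∈ Finset.range n, X j ω) = ∑ j ∈ Finset.range n, X j := by
    funext ω; simp
  constructor
  · have := hind.integrable_exp_mul_sum hmeas (s := Finset.range n) fun j _ => hint j
    simpa [hX] using this
  · change cgf (fun ω => ∑ j ∈ Finset.range n, X j ω) P θ = _
    rw [hfun, hind.cgf_sum hmeas fun j _ => hint j]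
    refine Finset.sum_congr rfl fun j _ => ?_
    have e : cgf (X j) P θ = cgf (Z δ) P (c j * θ) := by
      rw [cgf, cgf, ← congrFun (mgf_congr_identDistrib (hid j)) (c j * θ)]
      simp only [hX, mgf_const_mul]
    rw [e, hZ.cgf_eq (by simpa [mul_comm] using h j)]

end IsSubordinator

/-! ### Stationarity determines the cumulant generating function -/

section Stationary

variable {Ω : Type*} [MeasurableSpace Ω] {P : Measure Ω} {Z : ℝ≥0 → Ω → ℝ} {lam : ℝ≥0}

lemma IsSubordinator.ou_bounds {Ω' : Type*} [MeasurableSpace Ω'] {P' : Measure Ω'}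
    {V : ℝ≥0 → Ω' → ℝ} {V₀ : Ω' → ℝ} {q : Ω' → Ω} (hq : Measure.QuasiMeasurePreserving q P' P)
    (hZ : IsSubordinator P Z) (hlam : 0 < lam)
    (hV : IsOUProcess P' lam (fun t p => Z t (q p)) V V₀) (t : ℝ≥0) :
    ∀ᵐ p ∂P', Real.exp (-lam * t) * V₀ p + Real.exp (-lam * t) * Z (lam * t) (q p) ≤ V t p ∧
      V t p ≤ Real.exp (-lam * t) * V₀ p + Z (lam * t) (q p) := by
  filter_upwards [hV, hq.ae hZ.start, hq.ae hZ.monotone_paths,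
    hq.ae hZ.rightContinuous_paths] with p hp h0 hm hr
  refine ou_equation_bounds (v := fun t => V t p) (z := fun t => Z (lam * t) (q p))
    (by exact_mod_cast hlam) (fun s u h => hm (by gcongr)) (by simpa using h0) (fun s => ?_)
    (fun s => hp s) t
  exact (hr (lam * s)).comp (f := fun u : ℝ≥0 => lam * u) (by fun_prop)
    fun u hu => mul_le_mul_right (show s ≤ u from hu) _

variable [IsProbabilityMeasure P] {D : Measure ℝ} [IsProbabilityMeasure D]

/-- The path bounds at time `h / lam` are exponentiated and integrated against the product measure.
Lower integrals are used because exponential moments of `Z` are not yet known to be finite; the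
first inequality will prove that they are. -/
lemma IsStationaryLaw.lintegral_exp_bounds (hZ : IsSubordinator P Z) (hlam : 0 < lam)
    (hS : IsStationaryLaw P lam Z D) {θ : ℝ} (hθ : 0 ≤ θ) (h : ℝ≥0) :
    (∫⁻ x, ENNReal.ofReal (Real.exp (θ * Real.exp (-h) * x)) ∂D) *
        (∫⁻ ω, ENNReal.ofReal (Real.exp (θ * Real.exp (-h) * Z h ω)) ∂P) ≤
      ∫⁻ x, ENNReal.ofReal (Real.exp (θ * x)) ∂D ∧
    ∫⁻ x, ENNReal.ofReal (Real.exp (θ * x)) ∂D ≤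
      (∫⁻ x, ENNReal.ofReal (Real.exp (θ * Real.exp (-h) * x)) ∂D) *
        (∫⁻ ω, ENNReal.ofReal (Real.exp (θ * Z h ω)) ∂P) := by
  obtain ⟨Y, hY, hlaw⟩ := hS
  set t : ℝ≥0 := h / lam with ht
  have hlt : lam * t = h := by rw [ht]; field_simp
  have hlt' : (-(lam : ℝ) * t) = -h := by rw [← hlt]; push_cast; ring
  -- The pushforward along a map that is not a.e. measurable is `0` by convention, which cannot be
  -- the probability measure `D`.
  have hYm : AEMeasurable (Y t) (D.prod P) := by
    by_contra hn
    have := hlaw t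
    rw [Measure.map_of_not_aemeasurable hn] at this
    exact IsProbabilityMeasure.ne_zero D this.symm
  have hb := hZ.ou_bounds (q := Prod.snd) Measure.quasiMeasurePreserving_snd hlam hY t
  simp only [hlt, hlt'] at hb
  have hmid : ∫⁻ x, ENNReal.ofReal (Real.exp (θ * x)) ∂D =
      ∫⁻ p, ENNReal.ofReal (Real.exp (θ * Y t p)) ∂(D.prod P) := by
    conv_lhs => rw [← hlaw t]
    rw [lintegral_map' (by fun_prop) hYm]
  have hZm := hZ.measurable h
  rw [← lintegral_prod_mul (by fun_prop) (by fun_prop),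
    ← lintegral_prod_mul (by fun_prop) (by fun_prop), hmid]
  constructor
  · refine lintegral_mono_ae ?_
    filter_upwards [hb] with p hp
    rw [← ENNReal.ofReal_mul (Real.exp_nonneg _), ← Real.exp_add]
    gcongr
    nlinarith [mul_le_mul_of_nonneg_left hp.1 hθ]
  · refine lintegral_mono_ae ?_
    filter_upwards [hb] with p hp
    rw [← ENNReal.ofReal_mul (Real.exp_nonneg _), ← Real.exp_add]
    gcongr
    nlinarith [mul_le_mul_of_nonneg_left hp.2 hθ]

end Stationary

section InverseGaussianKappa

variable {Ω : Type*} [MeasurableSpace Ω] {P : Measure Ω} [IsProbabilityMeasure P]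
  {Z : ℝ≥0 → Ω → ℝ} {lam : ℝ≥0} {a b : ℝ}

/-- For `θ > 0`, take `h = 1` and the exponent `θ e` in the lower stationarity bound. The transform
of `IG(a, b)` is finite at `θ e` when `2 θ e < b²`, whence the threshold. -/
lemma integrable_exp_of_stationary (hZ : IsSubordinator P Z) (hlam : 0 < lam) (ha : 0 < a)
    (hb : 0 < b) (hS : IsStationaryLaw P lam Z (inverseGaussian a b)) {θ : ℝ}
    (hθ : θ < b ^ 2 / (2 * Real.exp 1)) : Integrable (fun ω => Real.exp (θ * Z 1 ω)) P := by
  rcases le_or_gt θ 0 with h0 | h0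
  · exact hZ.integrable_exp_of_nonpos h0 1
  have := isProbabilityMeasure_inverseGaussian ha hb
  have he : 0 < Real.exp 1 := Real.exp_pos _
  have h1 : 0 < b ^ 2 - 2 * (θ * Real.exp 1) := by
    rw [lt_div_iff₀ (by positivity)] at hθ; linarith
  have h2 : 0 < b ^ 2 - 2 * θ := by nlinarith [Real.one_le_exp (zero_le_one (α := ℝ))]
  have key := (hS.lintegral_exp_bounds hZ hlam (θ := θ * Real.exp 1) (by positivity) 1).1
  have e : θ * Real.exp 1 * Real.exp (-(1 : ℝ≥0)) = θ := by
    rw [mul_assoc, ← Real.exp_add]; simp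
  rw [e, lintegral_exp_inverseGaussian ha h1, lintegral_exp_inverseGaussian ha h2] at key
  refine ⟨((hZ.measurable 1).const_mul θ).exp.aestronglyMeasurable, ?_⟩
  rw [hasFiniteIntegral_iff_ofReal (Eventually.of_forall fun ω => Real.exp_nonneg _)]
  refine lt_top_iff_ne_top.2 fun htop => ?_
  rw [htop, ENNReal.mul_top (by simp [Real.exp_pos])] at key
  exact ENNReal.ofReal_ne_top (top_le_iff.1 key)

lemma kappa_bounds_of_stationary (hZ : IsSubordinator P Z) (hlam : 0 < lam) (ha : 0 < a)
    (hb : 0 < b) (hS : IsStationaryLaw P lam Z (inverseGaussian a b)) {θ : ℝ}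
    (h0 : 0 ≤ θ) (hθ : θ < b ^ 2 / (2 * Real.exp 1)) (h : ℝ≥0) :
    h * kappa P Z (θ * Real.exp (-h)) ≤
        a * √(b ^ 2 - 2 * (θ * Real.exp (-h))) - a * √(b ^ 2 - 2 * θ) ∧
      a * √(b ^ 2 - 2 * (θ * Real.exp (-h))) - a * √(b ^ 2 - 2 * θ) ≤ h * kappa P Z θ := by
  have := isProbabilityMeasure_inverseGaussian ha hb
  have he : 0 < Real.exp 1 := Real.exp_pos _
  have hb2 : 0 < b ^ 2 := by positivity
  have h2 : 0 < b ^ 2 - 2 * θ := by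
    rw [lt_div_iff₀ (by positivity)] at hθ
    nlinarith [Real.one_le_exp (zero_le_one (α := ℝ))]
  have hle : θ * Real.exp (-h) ≤ θ :=
    mul_le_of_le_one_right h0 (Real.exp_le_one_iff.2 (by simp))
  have h3 : 0 < b ^ 2 - 2 * (θ * Real.exp (-h)) := by linarith
  have hlint : ∀ u, u < b ^ 2 / (2 * Real.exp 1) →
      ∫⁻ ω, ENNReal.ofReal (Real.exp (u * Z h ω)) ∂P =
        ENNReal.ofReal (Real.exp (h * kappa P Z u)) := fun u hu => by
    have hi := integrable_exp_of_stationary hZ hlam ha hb hS hu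
    rw [← ofReal_integral_eq_lintegral_ofReal (hZ.integrable_exp hi h)
      (Eventually.of_forall fun ω => Real.exp_nonneg _), ← hZ.mgf_eq hi, mgf]
  obtain ⟨k1, k2⟩ := hS.lintegral_exp_bounds hZ hlam h0 h
  rw [lintegral_exp_inverseGaussian ha h2, lintegral_exp_inverseGaussian ha h3,
    hlint _ (hle.trans_lt hθ), ← ENNReal.ofReal_mul (Real.exp_nonneg _), ← Real.exp_add,
    ENNReal.ofReal_le_ofReal_iff (Real.exp_nonneg _), Real.exp_le_exp] at k1
  rw [lintegral_exp_inverseGaussian ha h2, lintegral_exp_inverseGaussian ha h3,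
    hlint _ hθ, ← ENNReal.ofReal_mul (Real.exp_nonneg _), ← Real.exp_add,
    ENNReal.ofReal_le_ofReal_iff (Real.exp_nonneg _), Real.exp_le_exp] at k2
  constructor <;> linarith

lemma mem_interior_integrableExpSet_of_stationary (hZ : IsSubordinator P Z) (hlam : 0 < lam) (ha : 0 < a)
    (hb : 0 < b) (hS : IsStationaryLaw P lam Z (inverseGaussian a b)) {θ : ℝ}
    (hθ : θ < b ^ 2 / (2 * Real.exp 1)) : θ ∈ interior (integrableExpSet (Z 1) P) :=
  mem_interior_iff_mem_nhds.2 <| by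
    filter_upwards [gt_mem_nhds hθ] with u hu
    exact integrable_exp_of_stationary hZ hlam ha hb hS hu

/-- Divided by `h`, the stationarity bounds trap a difference quotient at `0` of `S h = a √(b² - 2 θ
exp (-h))` between `κ(θ exp (-h))` and `κ(θ)`. As `h → 0+` both ends meet by continuity of `κ`. -/
lemma kappa_eq_of_pos (hZ : IsSubordinator P Z) (hlam : 0 < lam) (ha : 0 < a)
    (hb : 0 < b) (hS : IsStationaryLaw P lam Z (inverseGaussian a b)) {θ : ℝ}
    (h0 : 0 < θ) (hθ : θ < b ^ 2 / (2 * Real.exp 1)) :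
    kappa P Z θ = a * θ / √(b ^ 2 - 2 * θ) := by
  have h2 : 0 < b ^ 2 - 2 * θ := by
    rw [lt_div_iff₀ (by positivity)] at hθ
    nlinarith [Real.one_le_exp (zero_le_one (α := ℝ)), Real.exp_pos 1]
  set S : ℝ → ℝ := fun h => a * √(b ^ 2 - 2 * (θ * Real.exp (-h))) with hS'
  have hd : HasDerivAt S (a * θ / √(b ^ 2 - 2 * θ)) 0 := by
    have h1 : HasDerivAt (fun h : ℝ => b ^ 2 - 2 * (θ * Real.exp (-h))) (2 * θ) 0 := by
      have := ((((hasDerivAt_id (0 : ℝ)).neg.exp).const_mul θ).const_mul 2).const_sub (b ^ 2)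
      simpa using this
    have h3 := (h1.sqrt (by simpa using h2.ne')).const_mul a
    refine h3.congr_deriv ?_
    simp only [neg_zero, Real.exp_zero, mul_one]
    field_simp
  have hslope := hd.tendsto_slope_zero_right
  have hkc : ContinuousAt (kappa P Z) θ :=
    (analyticAt_cgf (mem_interior_integrableExpSet_of_stationary hZ hlam ha hb hS hθ)).continuousAt
  have hlow : Tendsto (fun h : ℝ => kappa P Z (θ * Real.exp (-h))) (𝓝[>] 0) (𝓝 (kappa P Z θ)) := by
    have h1 : Tendsto (fun h : ℝ => θ * Real.exp (-h)) (𝓝[>] 0) (𝓝 θ) := by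
      have : ContinuousAt (fun h : ℝ => θ * Real.exp (-h)) 0 := by fun_prop
      have := this.tendsto
      simp only [neg_zero, Real.exp_zero, mul_one] at this
      exact this.mono_left nhdsWithin_le_nhds
    exact hkc.tendsto.comp h1
  have hb' : ∀ h : ℝ, 0 < h → kappa P Z (θ * Real.exp (-h)) ≤ h⁻¹ • (S (0 + h) - S 0) ∧
      h⁻¹ • (S (0 + h) - S 0) ≤ kappa P Z θ := fun h hh => by
    obtain ⟨k1, k2⟩ := kappa_bounds_of_stationary hZ hlam ha hb hS h0.le hθ h.toNNReal
    rw [Real.coe_toNNReal h hh.le] at k1 k2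
    simp only [hS', zero_add, smul_eq_mul, neg_zero, Real.exp_zero, mul_one]
    exact ⟨(le_inv_mul_iff₀ hh).2 k1, (inv_mul_le_iff₀ hh).2 k2⟩
  refine le_antisymm ?_ ?_
  · refine le_of_tendsto_of_tendsto hlow hslope ?_
    filter_upwards [self_mem_nhdsWithin] with h hh using (hb' h hh).1
  · refine le_of_tendsto hslope ?_
    filter_upwards [self_mem_nhdsWithin] with h hh using (hb' h hh).2

end InverseGaussianKappa

/-! ### Derivatives of the cumulant generating function at the origin -/

section KappaDerivatives

lemma doubleFactorial_two_mul_add_one (n : ℕ) : (2 * n + 1)‼ = (2 * n + 1) * (2 * n - 1)‼ := by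
  cases n with
  | zero => rfl
  | succ n => rw [show 2 * (n + 1) + 1 = (2 * n + 1) + 2 by ring, Nat.doubleFactorial]; rfl

/-- This closed form is the shape in which derivatives of `θ * g θ` at `0` appear. For `n = 0` the
truncated `2 * n - 1` is `0`, and `0‼ = 1` plays the role of `(-1)!!`. -/
lemma phi_succ (n : ℕ) : phi (n + 1) = (n + 1) * (2 * n - 1)‼ := by
  induction n with
  | zero => rfl
  | succ n ih =>
    rw [phi, ih, show 2 * (n + 1) - 1 = 2 * n + 1 by omega, doubleFactorial_two_mul_add_one]
    ring

lemma iteratedDeriv_const_mul_rpow_neg_half (a c : ℝ) (k : ℕ) {θ : ℝ} (hθ : 0 < c - 2 * θ) :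
    iteratedDeriv k (fun θ : ℝ => a * (c - 2 * θ) ^ (-(1 / 2) : ℝ)) θ =
      a * ((2 * k - 1)‼ : ℕ) * (c - 2 * θ) ^ (-(1 / 2) - k : ℝ) := by
  induction k generalizing θ with
  | zero => simp
  | succ k ih =>
    have hev : iteratedDeriv k (fun θ : ℝ => a * (c - 2 * θ) ^ (-(1 / 2) : ℝ)) =ᶠ[𝓝 θ]
        fun θ => a * ((2 * k - 1)‼ : ℕ) * (c - 2 * θ) ^ (-(1 / 2) - k : ℝ) := by
      have : ∀ᶠ u in 𝓝 θ, 0 < c - 2 * u :=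
        (by fun_prop : ContinuousAt (fun u : ℝ => c - 2 * u) θ).eventually (lt_mem_nhds hθ)
      filter_upwards [this] with u hu using ih hu
    have h1 : HasDerivAt (fun u : ℝ => c - 2 * u) (-2) θ := by
      simpa using ((hasDerivAt_id θ).const_mul 2).const_sub c
    have h2 := (h1.rpow_const (p := -(1 / 2) - k) (Or.inl hθ.ne')).const_mul
      (a * ((2 * k - 1)‼ : ℕ))
    rw [iteratedDeriv_succ, hev.deriv_eq, h2.deriv, show 2 * (k + 1) - 1 = 2 * k + 1 by omega,
      doubleFactorial_two_mul_add_one]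
    push_cast
    rw [show (-(1 / 2) - k - 1 : ℝ) = -(1 / 2) - (k + 1) by ring]
    ring

lemma iteratedDeriv_id_mul_zero {g : ℝ → ℝ} (k : ℕ) (hg : ContDiffAt ℝ (k + 1 : ℕ) g 0) :
    iteratedDeriv (k + 1) (fun θ => θ * g θ) 0 = (k + 1) * iteratedDeriv k g 0 := by
  rw [iteratedDeriv_fun_mul (f := fun θ : ℝ => θ) contDiffAt_id hg, Finset.sum_eq_single 1]
  · simp [iteratedDeriv_fun_id_zero]
  · intro i _ hi
    simp [iteratedDeriv_fun_id_zero, hi]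
  · simp

variable {Ω : Type*} [MeasurableSpace Ω] {P : Measure Ω} [IsProbabilityMeasure P]
  {Z : ℝ≥0 → Ω → ℝ} {lam : ℝ≥0} {a b : ℝ}

/-- Identity theorem: both sides are analytic at `0` and agree on a right neighbourhood. -/
lemma kappa_eventuallyEq (hZ : IsSubordinator P Z) (hlam : 0 < lam) (ha : 0 < a)
    (hb : 0 < b) (hS : IsStationaryLaw P lam Z (inverseGaussian a b)) :
    kappa P Z =ᶠ[𝓝 0] fun θ => θ * (a * (b ^ 2 - 2 * θ) ^ (-(1 / 2) : ℝ)) := by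
  have hr : 0 < b ^ 2 / (2 * Real.exp 1) := by positivity
  have hb2 : b ^ 2 - 2 * 0 ≠ 0 := by simp [hb.ne']
  have h1 : AnalyticAt ℝ (kappa P Z) 0 :=
    analyticAt_cgf (mem_interior_integrableExpSet_of_stationary hZ hlam ha hb hS hr)
  have h2 : AnalyticAt ℝ (fun θ => θ * (a * (b ^ 2 - 2 * θ) ^ (-(1 / 2) : ℝ))) 0 := by
    refine analyticAt_id.mul (analyticAt_const.mul (ContDiffAt.analyticAt ?_))
    exact (contDiffAt_const.sub (contDiffAt_const.mul contDiffAt_id)).rpow_const_of_ne hb2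
  refine (h1.frequently_eq_iff_eventually_eq h2).1 ?_
  have hev : ∀ᶠ θ in 𝓝[>] (0 : ℝ),
      kappa P Z θ = θ * (a * (b ^ 2 - 2 * θ) ^ (-(1 / 2) : ℝ)) := by
    filter_upwards [Ioo_mem_nhdsGT hr] with θ hθ
    have h2 : 0 < b ^ 2 - 2 * θ := by
      have := hθ.2
      rw [lt_div_iff₀ (by positivity)] at this
      nlinarith [Real.one_le_exp (zero_le_one (α := ℝ)), hθ.1]
    rw [kappa_eq_of_pos hZ hlam ha hb hS hθ.1 hθ.2, Real.rpow_neg h2.le, ← Real.sqrt_eq_rpow]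
    ring
  exact hev.frequently.filter_mono (nhdsWithin_mono _ fun x hx => ne_of_gt hx)

lemma iteratedDeriv_kappa (hZ : IsSubordinator P Z) (hlam : 0 < lam) (ha : 0 < a)
    (hb : 0 < b) (hS : IsStationaryLaw P lam Z (inverseGaussian a b)) (j : ℕ) :
    iteratedDeriv (j + 1) (kappa P Z) 0 = phi (j + 1) * a / b ^ (2 * j + 1) := by
  have hb2 : 0 < b ^ 2 - 2 * 0 := by simpa using pow_pos hb 2
  rw [(kappa_eventuallyEq hZ hlam ha hb hS).iteratedDeriv_eq, iteratedDeriv_id_mul_zero,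
    iteratedDeriv_const_mul_rpow_neg_half _ _ _ hb2, phi_succ]
  · have : (b ^ 2 - 2 * 0 : ℝ) ^ (-(1 / 2) - j : ℝ) = 1 / b ^ (2 * j + 1) := by
      rw [mul_zero, sub_zero, ← Real.rpow_natCast b 2, ← Real.rpow_mul hb.le,
        ← Real.rpow_natCast b (2 * j + 1), one_div (b ^ _), ← Real.rpow_neg hb.le]
      congr 1; push_cast; ring
    rw [this]; push_cast; ring
  · exact contDiffAt_const.mul
      ((contDiffAt_const.sub (contDiffAt_const.mul contDiffAt_id)).rpow_const_of_ne hb2.ne')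

lemma cgf_deriv_one_eq_mean {X : Ω → ℝ} (h : 0 ∈ interior (integrableExpSet X P)) :
    iteratedDeriv 1 (cgf X P) 0 = ∫ ω, X ω ∂P := by
  rw [iteratedDeriv_one, deriv_cgf_zero h]; simp

/-- Jensen's inequality for the cumulant generating function. -/
lemma mul_integral_le_cgf {X : Ω → ℝ} (hX : Integrable X P) {θ : ℝ}
    (h : Integrable (fun ω => Real.exp (θ * X ω)) P) : θ * ∫ ω, X ω ∂P ≤ cgf X P θ := by
  rw [cgf, Real.le_log_iff_exp_le (mgf_pos h), mgf, ← integral_const_mul]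
  exact convexOn_exp.map_integral_le Real.continuous_exp.continuousOn isClosed_univ
    (by simp) (hX.const_mul θ) h

end KappaDerivatives

/-! ### Cumulants of affine combinations of increments -/

section AffineCumulants

lemma iteratedDeriv_comp_const_mul_apply (f : ℝ → ℝ) (c x : ℝ) (k : ℕ) :
    iteratedDeriv k (fun x => f (c * x)) x = c ^ k * iteratedDeriv k f (c * x) := by
  induction k generalizing f with
  | zero => simp
  | succ k ih =>
    have : deriv (fun x => f (c * x)) = fun x => c * deriv f (c * x) := by
      funext y; simpa using deriv_comp_mul_left c f y
    rw [iteratedDeriv_succ', this, iteratedDeriv_const_mul_field, ih, iteratedDeriv_succ']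
    ring

lemma iteratedDeriv_mul_add_sum_comp {f : ℝ → ℝ} (hf : AnalyticAt ℝ f 0) (m δ : ℝ) (c : ℕ → ℝ)
    (n k : ℕ) :
    iteratedDeriv (k + 1) (fun θ => θ * m + ∑ j ∈ Finset.range n, δ * f (c j * θ)) 0 =
      (if k = 0 then m else 0) +
        ∑ j ∈ Finset.range n, δ * (c j ^ (k + 1) * iteratedDeriv (k + 1) f 0) := by
  have hc : ∀ j, ContDiffAt ℝ (k + 1 : ℕ) (fun θ => δ * f (c j * θ)) 0 := fun j => by
    have h0 : AnalyticAt ℝ f (c j * 0) := by rwa [mul_zero]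
    have : AnalyticAt ℝ (fun θ => f (c j * θ)) 0 :=
      AnalyticAt.fun_comp h0 (analyticAt_const.mul analyticAt_id)
    exact (analyticAt_const.mul this).contDiffAt
  have hm : ContDiffAt ℝ (k + 1 : ℕ) (fun θ : ℝ => θ * m) 0 := by fun_prop
  rw [iteratedDeriv_fun_add hm (ContDiffAt.sum fun j _ => hc j), iteratedDeriv_fun_sum fun j _ => hc j]
  congr 1
  · have := iteratedDeriv_mul_const_field (n := k + 1) (x := (0 : ℝ)) (fun θ : ℝ => θ) m
    rw [iteratedDeriv_fun_id_zero] at this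
    rw [this]
    by_cases hk : k = 0 <;> simp [hk]
  · refine Finset.sum_congr rfl fun j _ => ?_
    rw [iteratedDeriv_const_mul_field, iteratedDeriv_comp_const_mul_apply, mul_zero]

variable {Ω : Type*} [MeasurableSpace Ω] {P : Measure Ω} [IsProbabilityMeasure P]
  {Z : ℝ≥0 → Ω → ℝ} {lam : ℝ≥0} {a b : ℝ}

/-- By independence the cumulant generating function near `0` is `θ m + ∑ δ κ(c j θ)`. Equality of
`X` is only almost sure so that `Z 0 = 0` may be used when a single increment represents `Z (lam *
T)`. -/
lemma cumulants_const_add_sum_increments (hZ : IsSubordinator P Z) (hlam : 0 < lam) (ha : 0 < a)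
    (hb : 0 < b) (hS : IsStationaryLaw P lam Z (inverseGaussian a b)) (m : ℝ) {c : ℕ → ℝ} {C : ℝ}
    (hc : ∀ j, 0 ≤ c j ∧ c j ≤ C) (δ : ℝ≥0) (n : ℕ) {X : Ω → ℝ}
    (hX : X =ᵐ[P] fun ω =>
      m + ∑ j ∈ Finset.range n, c j * (Z ((j + 1 : ℕ) * δ) ω - Z (j * δ) ω)) :
    0 ∈ interior (integrableExpSet X P) ∧ ∀ k, iteratedDeriv (k + 1) (cgf X P) 0 =
      (if k = 0 then m else 0) + ∑ j ∈ Finset.range n,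
        δ * (c j ^ (k + 1) * (phi (k + 1) * a / b ^ (2 * k + 1))) := by
  have hr : 0 < b ^ 2 / (2 * Real.exp 1) := by positivity
  have hev : ∀ᶠ θ in 𝓝 (0 : ℝ), Integrable (fun ω => Real.exp (θ * X ω)) P ∧
      cgf X P θ = θ * m + ∑ j ∈ Finset.range n, δ * kappa P Z (c j * θ) := by
    have hsmall : ∀ᶠ θ in 𝓝 (0 : ℝ), |θ| * C < b ^ 2 / (2 * Real.exp 1) := by
      have : ContinuousAt (fun θ : ℝ => |θ| * C) 0 := by fun_prop
      exact this.eventually (gt_mem_nhds (by simpa using hr))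
    filter_upwards [hsmall] with θ hθ
    have hi : ∀ j, Integrable (fun ω => Real.exp (θ * c j * Z 1 ω)) P := fun j => by
      refine integrable_exp_of_stationary hZ hlam ha hb hS (lt_of_le_of_lt ?_ hθ)
      calc θ * c j ≤ |θ| * c j := mul_le_mul_of_nonneg_right (le_abs_self _) (hc j).1
        _ ≤ |θ| * C := mul_le_mul_of_nonneg_left (hc j).2 (abs_nonneg _)
    obtain ⟨h1, h2⟩ := hZ.cgf_sum_increments c δ n hi
    refine ⟨(h1.const_mul (Real.exp (θ * m))).congr ?_, ?_⟩
    · filter_upwards [hX] with ω hω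
      rw [hω, ← Real.exp_add, mul_add]
    · rw [← h2, cgf, mgf_congr hX, mgf_const_add, Real.log_mul (Real.exp_pos _).ne'
        (mgf_pos h1).ne', Real.log_exp, cgf]
  refine ⟨mem_interior_iff_mem_nhds.2 (hev.mono fun θ h => h.1), fun k => ?_⟩
  rw [Filter.EventuallyEq.iteratedDeriv_eq (k + 1) (hev.mono fun θ h => h.2),
    iteratedDeriv_mul_add_sum_comp (f := kappa P Z)
    (analyticAt_cgf (mem_interior_integrableExpSet_of_stationary hZ hlam ha hb hS hr)),
    iteratedDeriv_kappa hZ hlam ha hb hS]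

end AffineCumulants

/-! ### The bounding polynomials -/

section Polynomials

/-- The quotient of `momentSeq s r (n + 1)` by `s`. -/
def momentFactor {R : Type*} [CommSemiring R] (s : R) (r : ℕ → R) (n : ℕ) : R :=
  ∑ j ∈ Finset.range (n + 1), (n.choose j : R) * r j * momentSeq s r (n - j)

lemma momentSeq_succ_eq {R : Type*} [CommSemiring R] (s : R) (r : ℕ → R) (n : ℕ) :
    momentSeq s r (n + 1) = s * momentFactor s r n :=
  momentSeq_succ s r n

lemma map_momentFactor {R S : Type*} [CommSemiring R] [CommSemiring S] (f : R →+* S) (s : R)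
    (r : ℕ → R) (n : ℕ) :
    f (momentFactor s r n) = momentFactor (f s) (fun j => f (r j)) n := by
  simp only [momentFactor, map_sum, map_mul, map_natCast, map_momentSeq]

open MvPolynomial in
/-- The polynomial bounding the central moments of the integrated variance, in the variables
`a, 1 / lam, 1 / b, T`. -/
noncomputable def centralMomentPoly : ℕ → MvPolynomial (Fin 4) ℝ≥0
  | 0 => 0
  | n + 1 => momentFactor (X 0 * X 3 * X 1 * X 2)
      (fun | 0 => 0 | j + 1 => (X 1 * X 2) ^ j * (phi (j + 2) : MvPolynomial (Fin 4) ℝ≥0)) n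

open MvPolynomial in
/-- The polynomial bounding the moments `G`, in the variables
`a, lam, 1 / b, T, |ρ|, exp (-lam T κ(ρ))`. -/
noncomputable def momentPoly : ℕ → MvPolynomial (Fin 6) ℝ≥0
  | 0 => 0
  | n + 1 => momentFactor (X 0 * X 1 * X 3 * X 4)
      (fun j => (X 4 * X 2) ^ j * (phi (j + 1) : MvPolynomial (Fin 6) ℝ≥0) +
        if j = 0 then C (1 / 2) * X 5 + C (1 / 2) else 0) n

lemma eval_centralMomentPoly (x : Fin 4 → ℝ) (n : ℕ) :
    ((centralMomentPoly (n + 1)).map NNReal.toRealHom).eval x =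
      momentFactor (x 0 * x 3 * x 1 * x 2)
        (fun | 0 => 0 | j + 1 => (x 1 * x 2) ^ j * (phi (j + 2) : ℝ)) n := by
  change ((MvPolynomial.eval x).comp (MvPolynomial.map NNReal.toRealHom)) _ = _
  rw [centralMomentPoly, map_momentFactor]
  congr 1
  · simp
  · funext j
    cases j <;> simp

lemma eval_momentPoly (x : Fin 6 → ℝ) (n : ℕ) :
    ((momentPoly (n + 1)).map NNReal.toRealHom).eval x =
      momentFactor (x 0 * x 1 * x 3 * x 4)
        (fun j => (x 4 * x 2) ^ j * (phi (j + 1) : ℝ) +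
          if j = 0 then 1 / 2 * x 5 + 1 / 2 else 0) n := by
  change ((MvPolynomial.eval x).comp (MvPolynomial.map NNReal.toRealHom)) _ = _
  rw [momentPoly, map_momentFactor]
  congr 1
  · simp
  · funext j
    split_ifs <;> simp

end Polynomials

/-! ### Passage to the limit and the final bounds -/

section Limits

variable {Ω : Type*} [MeasurableSpace Ω] {P : Measure Ω}

/-- Dominated convergence twice: for the means with dominating function `B`, then for the centred
powers with `(B + E[B])^N`. -/
lemma abs_central_moment_le_of_tendsto {X : Ω → ℝ} {Xn : ℕ → Ω → ℝ} {B : Ω → ℝ} {N : ℕ} {K : ℝ}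
    (hm : ∀ n, AEStronglyMeasurable (Xn n) P) (hB : Integrable B P)
    (hBN : Integrable (fun ω => (B ω + ∫ ω', B ω' ∂P) ^ N) P)
    (hbound : ∀ n, ∀ᵐ ω ∂P, |Xn n ω| ≤ B ω)
    (hlim : ∀ᵐ ω ∂P, Tendsto (fun n => Xn n ω) atTop (𝓝 (X ω)))
    (hK : ∀ n, |∫ ω, (Xn n ω - ∫ ω', Xn n ω' ∂P) ^ N ∂P| ≤ K) :
    Integrable X P ∧ Integrable (fun ω => (X ω - ∫ ω', X ω' ∂P) ^ N) P ∧
      |∫ ω, (X ω - ∫ ω', X ω' ∂P) ^ N ∂P| ≤ K := by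
  have hXm : AEStronglyMeasurable X P := aestronglyMeasurable_of_tendsto_ae atTop hm hlim
  have hXB : ∀ᵐ ω ∂P, |X ω| ≤ B ω := by
    filter_upwards [ae_all_iff.2 hbound, hlim] with ω h1 h2
    exact le_of_tendsto h2.abs (Eventually.of_forall h1)
  have hE := tendsto_integral_of_dominated_convergence B hm hB hbound hlim
  have habs : ∀ {Y : Ω → ℝ}, (∀ᵐ ω ∂P, |Y ω| ≤ B ω) →
      ∀ᵐ ω ∂P, ‖(Y ω - ∫ ω', Y ω' ∂P) ^ N‖ ≤ (B ω + ∫ ω', B ω' ∂P) ^ N := fun {Y} hY => by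
    have h1 : |∫ ω, Y ω ∂P| ≤ ∫ ω, B ω ∂P := by
      rw [← Real.norm_eq_abs]
      exact norm_integral_le_of_norm_le hB hY
    filter_upwards [hY] with ω hω
    rw [norm_pow, Real.norm_eq_abs]
    exact pow_le_pow_left₀ (abs_nonneg _) ((abs_sub _ _).trans (add_le_add hω h1)) N
  have hlimN : ∀ᵐ ω ∂P, Tendsto (fun n => (Xn n ω - ∫ ω', Xn n ω' ∂P) ^ N) atTop
      (𝓝 ((X ω - ∫ ω', X ω' ∂P) ^ N)) := by
    filter_upwards [hlim] with ω hω using (hω.sub hE).pow N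
  have hEN := tendsto_integral_of_dominated_convergence _
    (fun n => ((hm n).sub aestronglyMeasurable_const).pow N) hBN (fun n => habs (hbound n)) hlimN
  exact ⟨hB.mono' hXm hXB,
    hBN.mono' ((hXm.sub aestronglyMeasurable_const).pow N) (habs hXB),
    le_of_tendsto hEN.abs (Eventually.of_forall hK)⟩

end Limits

section Bounds

variable {Ω : Type*} [MeasurableSpace Ω] {P : Measure Ω} [IsProbabilityMeasure P]
  {Z V : ℝ≥0 → Ω → ℝ} {lam T : ℝ≥0} {a b v₀ : ℝ}

lemma abs_central_moment_sum_increments_le (hZ : IsSubordinator P Z) (hlam : 0 < lam) (ha : 0 < a)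
    (hb : 0 < b) (hS : IsStationaryLaw P lam Z (inverseGaussian a b)) {c : ℕ → ℝ}
    (hc : ∀ j, 0 ≤ c j ∧ c j ≤ 1 / lam) {n : ℕ} (hn : n ≠ 0) (m : ℝ) {X : Ω → ℝ}
    (hX : X = fun ω => m + ∑ j ∈ Finset.range n,
      c j * (Z ((j + 1 : ℕ) * (lam * (T / n))) ω - Z (j * (lam * (T / n))) ω)) (N : ℕ) :
    |∫ ω, (X ω - ∫ ω', X ω' ∂P) ^ (N + 1) ∂P| ≤ a * T / (lam * b ^ (N + 2)) *
      ((centralMomentPoly (N + 1)).map NNReal.toRealHom).eval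
        ![a, 1 / (lam : ℝ), 1 / b, (T : ℝ)] := by
  have hlam' : (0 : ℝ) < lam := by exact_mod_cast hlam
  set E := ∫ ω, X ω ∂P with hE
  have hXi : Integrable X P := integrable_of_mem_interior_integrableExpSet
    (cumulants_const_add_sum_increments hZ hlam ha hb hS m hc _ n hX.eventuallyEq).1
  obtain ⟨h0, hK⟩ := cumulants_const_add_sum_increments hZ hlam ha hb hS (m - E) hc
    (lam * (T / n)) n (X := fun ω => X ω - E)
    (Eventually.of_forall fun ω => by simp only [hX]; ring)
  have hK1 : iteratedDeriv (0 + 1) (cgf (fun ω => X ω - E) P) 0 = 0 := by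
    rw [zero_add, cgf_deriv_one_eq_mean h0, integral_sub hXi (integrable_const _)]
    simp [hE]
  have hδ : ∑ _j ∈ Finset.range n, ((lam * (T / n) : ℝ≥0) : ℝ) = lam * T := by
    have : (n : ℝ) ≠ 0 := by exact_mod_cast hn
    simp only [Finset.sum_const, Finset.card_range, nsmul_eq_mul]
    push_cast; field_simp
  have hk : ∀ k : ℕ, 0 ≤ (phi (k + 1) * a / b ^ (2 * k + 1) : ℝ) := fun k => by positivity
  -- As the steps sum to `lam T` and `c i ≤ 1/lam`, the cumulant of order `j + 2` is at most `lam T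
  -- (1/lam)^(j+2) φ_(j+2) a / b^(2j+3)`, which factors as `s * d^(j+2) * r (j+1)`. Centring allows
  -- `r 0 = 0`.
  obtain ⟨h1, h2⟩ := integral_pow_mem_Icc_of_cumulants h0 (s := a * T * (1 / lam) * (1 / b))
    (d := 1 / b) (r := fun | 0 => 0 | j + 1 => (1 / lam * (1 / b)) ^ j * (phi (j + 2) : ℝ))
    (fun j => by
      cases j with
      | zero => rw [hK1]
      | succ j =>
        rw [hK, if_neg j.succ_ne_zero, zero_add]
        exact Finset.sum_nonneg fun i _ =>
          mul_nonneg (NNReal.coe_nonneg _) (mul_nonneg (pow_nonneg (hc i).1 _) (hk _)))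
    (fun j => by
      cases j with
      | zero => rw [hK1]; simp
      | succ j =>
        rw [hK, if_neg j.succ_ne_zero, zero_add]
        calc ∑ i ∈ Finset.range n, ((lam * (T / n) : ℝ≥0) : ℝ) *
              (c i ^ (j + 1 + 1) * (phi (j + 1 + 1) * a / b ^ (2 * (j + 1) + 1)))
            ≤ ∑ i ∈ Finset.range n, ((lam * (T / n) : ℝ≥0) : ℝ) *
              ((1 / lam) ^ (j + 1 + 1) * (phi (j + 1 + 1) * a / b ^ (2 * (j + 1) + 1))) :=
              Finset.sum_le_sum fun i _ => mul_le_mul_of_nonneg_left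
                (mul_le_mul_of_nonneg_right (pow_le_pow_left₀ (hc i).1 (hc i).2 _) (hk _))
                (NNReal.coe_nonneg _)
          _ = a * T * (1 / lam) * (1 / b) * (1 / b) ^ (j + 1 + 1) *
              ((1 / lam * (1 / b)) ^ j * (phi (j + 2) : ℝ)) := by
              rw [← Finset.sum_mul, hδ]
              simp only [div_pow, one_pow, mul_pow, mul_add, pow_add, pow_mul, pow_one, mul_one]
              field_simp
              ring
          _ ≤ _ := le_rfl) (N + 1)
  rw [abs_of_nonneg h1]
  refine h2.trans (le_of_eq ?_)
  rw [eval_centralMomentPoly, momentSeq_succ_eq]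
  simp only [Matrix.cons_val]
  rw [show a * (T : ℝ) / (lam * b ^ (N + 2)) = (1 / b) ^ (N + 1) * (a * T * (1 / lam) * (1 / b)) by
    simp only [div_pow, one_pow, pow_add]; field_simp]
  exact (mul_assoc _ _ _).symm

lemma integrated_central_moments (hlam : 0 < lam) (ha : 0 < a) (hb : 0 < b)
    (hv₀ : 0 < v₀) (h : IsInverseGaussianOU P lam a b v₀ Z V) (N : ℕ) :
    Integrable (integrated V T) P ∧
      Integrable (fun ω => (integrated V T ω - ∫ ω', integrated V T ω' ∂P) ^ (N + 1)) P ∧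
      |∫ ω, (integrated V T ω - ∫ ω', integrated V T ω' ∂P) ^ (N + 1) ∂P| ≤
        a * T / (lam * b ^ (N + 2)) *
          ((centralMomentPoly (N + 1)).map NNReal.toRealHom).eval
            ![a, 1 / (lam : ℝ), 1 / b, (T : ℝ)] := by
  have hZ := h.subordinator
  have hS := h.stationary
  have hlam' : (0 : ℝ) < lam := by exact_mod_cast hlam
  choose c hc hcz using fun n : ℕ => exists_increment_weights hlam' T n.succ_ne_zero
  set m := (1 - Real.exp (-lam * T)) / lam * v₀ with hm
  have hm0 : 0 ≤ m := by
    have : Real.exp (-lam * T) ≤ 1 := Real.exp_le_one_iff.2 (by nlinarith [T.2])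
    have : 0 ≤ 1 - Real.exp (-lam * T) := by linarith
    positivity
  set L : ℕ → Ω → ℝ := fun n ω => m + ∑ j ∈ Finset.range (n + 1), c n j *
    (Z ((j + 1 : ℕ) * (lam * (T / (n + 1 : ℕ)))) ω - Z (j * (lam * (T / (n + 1 : ℕ)))) ω) with hL
  -- All weights are at most `1/lam` and the increments telescope, so `B` dominates every Riemann
  -- sum.
  set B : Ω → ℝ := fun ω => m + 1 / lam * Z (lam * T) ω with hB
  have hBi : ∀ m' : ℝ, 0 ∈ interior (integrableExpSet
      (fun ω => m' + 1 / lam * Z (lam * T) ω) P) := fun m' =>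
    (cumulants_const_add_sum_increments hZ hlam ha hb hS m' (c := fun _ => 1 / lam)
      (fun _ => ⟨by positivity, le_rfl⟩) (lam * T) 1 (by
        filter_upwards [hZ.start] with ω hω
        simp [hω])).1
  refine abs_central_moment_le_of_tendsto (Xn := L) (B := B) (fun n => ?_)
    (integrable_of_mem_interior_integrableExpSet (hBi m)) ?_ (fun n => ?_) ?_ (fun n => ?_)
  · have := hZ.measurable
    exact Measurable.aestronglyMeasurable (by simp only [hL]; fun_prop)
  · have := integrable_pow_of_mem_interior_integrableExpSet (hBi (m + ∫ ω, B ω ∂P)) (N + 1)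
    refine this.congr (Eventually.of_forall fun ω => ?_)
    simp only [hB]; ring
  · filter_upwards [hZ.start, hZ.monotone_paths] with ω h0 hmono
    set δ : ℝ≥0 := lam * (T / (n + 1 : ℕ)) with hδ
    have hnδ : ((n + 1 : ℕ) : ℝ≥0) * δ = lam * T := by
      rw [hδ]; push_cast; field_simp
    have hinc : ∀ j : ℕ, 0 ≤ Z ((j + 1 : ℕ) * δ) ω - Z (j * δ) ω := fun j =>
      sub_nonneg.2 (hmono (by gcongr; exact j.le_succ))
    have hs0 : 0 ≤ ∑ j ∈ Finset.range (n + 1), c n j * (Z ((j + 1 : ℕ) * δ) ω - Z (j * δ) ω) :=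
      Finset.sum_nonneg fun j _ => mul_nonneg (hc n j).1 (hinc j)
    have hs1 : ∑ j ∈ Finset.range (n + 1), c n j * (Z ((j + 1 : ℕ) * δ) ω - Z (j * δ) ω) ≤
        1 / lam * Z (lam * T) ω := by
      calc _ ≤ ∑ j ∈ Finset.range (n + 1), 1 / (lam : ℝ) *
            (Z ((j + 1 : ℕ) * δ) ω - Z (j * δ) ω) :=
            Finset.sum_le_sum fun j _ => mul_le_mul_of_nonneg_right (hc n j).2 (hinc j)
        _ = 1 / lam * Z (lam * T) ω := by
            rw [← Finset.mul_sum, Finset.sum_range_sub fun j : ℕ => Z (j * δ) ω, hnδ]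
            simp [h0]
    rw [abs_of_nonneg (add_nonneg hm0 hs0)]
    simp only [hB]
    linarith
  · filter_upwards [hZ.start, hZ.monotone_paths, hZ.rightContinuous_paths, h.isOU]
      with ω h0 hmono hr hou
    have hmono' : Monotone fun t => Z (lam * t) ω := fun s u hsu => hmono (by gcongr)
    have hI : integrated V T ω = m +
        ∫ s in (0 : ℝ)..T, Real.exp (-lam * (T - s)) * Z (lam * s.toNNReal) ω := by
      rw [hm, ← integral_ou_split hmono' hlam'.ne']
      refine integral_eq_of_ou_equation (v := fun t => V t ω) hmono' (fun s => ?_)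
        (fun s => hou s) T
      exact (hr (lam * s)).comp (f := fun u : ℝ≥0 => lam * u) (by fun_prop)
        fun u hu => mul_le_mul_right (show s ≤ u from hu) _
    have hrate : Tendsto (fun n : ℕ => (T : ℝ) / (n + 1 : ℕ) * Z (lam * T) ω) atTop (𝓝 0) := by
      have := (tendsto_const_div_atTop_nhds_zero_nat (T : ℝ)).comp (tendsto_add_atTop_nat 1)
      simpa using this.mul_const (Z (lam * T) ω)
    rw [tendsto_iff_dist_tendsto_zero]
    refine squeeze_zero (fun n => dist_nonneg) (fun n => ?_) hrate
    have := hcz n (fun t => Z (lam * t) ω) hmono' (by simpa using h0)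
    rw [dist_comm, Real.dist_eq, hI, hL]
    simp only [mul_left_comm (lam : ℝ≥0)] at this
    simpa only [add_sub_add_left_eq_sub] using this
  · exact abs_central_moment_sum_increments_le hZ hlam ha hb hS (hc n) n.succ_ne_zero m rfl N

/-- The constant part `m` enters only the first cumulant. It is nonnegative because `κ(ρ) ≤ 0`, and
Jensen's inequality bounds it by a multiple of `a lam T |ρ| / b`, so it fits the same scaling as the
cumulants of `|ρ| Z_{lam T}` at the price of an extra term in `r 0`. -/
lemma boundVariable_moments (hlam : 0 < lam) (ha : 0 < a) (hb : 0 < b)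
    (hZ : IsSubordinator P Z) (hS : IsStationaryLaw P lam Z (inverseGaussian a b)) {ρ : ℝ}
    (hρ : ρ ≤ 0) (N : ℕ) :
    Integrable (fun ω => boundVariable P Z lam T ρ ω ^ (N + 1)) P ∧
      G P Z lam T ρ (N + 1) ≤ a * lam * T * |ρ| / b ^ (N + 1) *
        ((momentPoly (N + 1)).map NNReal.toRealHom).eval ![a, (lam : ℝ), 1 / b, (T : ℝ), |ρ|,
          Real.exp (-(lam * T * kappa P Z ρ))] := by
  set e := Real.exp (-(lam * T * kappa P Z ρ)) with he
  have he0 : 0 < 1 / 2 * e + 1 / 2 := by have := Real.exp_pos (-(lam * T * kappa P Z ρ)); positivity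
  set m := -(lam * T * kappa P Z ρ) * (1 / 2 * e + 1 / 2) with hm
  have hr : 0 < b ^ 2 / (2 * Real.exp 1) := by positivity
  have hZ1 := mem_interior_integrableExpSet_of_stationary hZ hlam ha hb hS hr
  have hmean : ∫ ω, Z 1 ω ∂P = a / b := by
    rw [← cgf_deriv_one_eq_mean hZ1]
    have := iteratedDeriv_kappa hZ hlam ha hb hS 0
    simpa [phi] using! this
  have hκ : -kappa P Z ρ ≤ |ρ| * (a / b) := by
    have := mul_integral_le_cgf (integrable_of_mem_interior_integrableExpSet hZ1)
      (hZ.integrable_exp_of_nonpos hρ 1)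
    rw [hmean] at this
    rw [abs_of_nonpos hρ]
    unfold kappa
    linarith
  have hκ0 : kappa P Z ρ ≤ 0 := by
    refine Real.log_nonpos mgf_nonneg ?_
    calc mgf (Z 1) P ρ ≤ ∫ _, (1 : ℝ) ∂P := by
          refine integral_mono_ae (hZ.integrable_exp_of_nonpos hρ 1) (integrable_const _) ?_
          filter_upwards [hZ.ae_nonneg 1] with ω h0
          exact Real.exp_le_one_iff.2 (mul_nonpos_of_nonpos_of_nonneg hρ h0)
      _ = 1 := by simp
  have hm0 : 0 ≤ m := mul_nonneg (neg_nonneg.2 (mul_nonpos_of_nonneg_of_nonpos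
    (by positivity) hκ0)) he0.le
  have hm1 : m ≤ lam * T * (|ρ| * (a / b)) * (1 / 2 * e + 1 / 2) := by
    rw [hm, ← mul_neg]
    gcongr
  obtain ⟨h0, hK⟩ := cumulants_const_add_sum_increments hZ hlam ha hb hS m (c := fun _ => |ρ|)
    (C := |ρ|) (fun _ => ⟨abs_nonneg _, le_rfl⟩) (lam * T) 1 (X := boundVariable P Z lam T ρ) (by
      filter_upwards [hZ.start] with ω hω
      simp [boundVariable, hω, hm, he])
  refine ⟨integrable_pow_of_mem_interior_integrableExpSet h0 _, ?_⟩
  simp only [Finset.range_one, Finset.sum_singleton] at hK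
  obtain ⟨h1, h2⟩ := integral_pow_mem_Icc_of_cumulants h0 (s := a * lam * T * |ρ|)
    (d := 1 / b) (r := fun j => (|ρ| * (1 / b)) ^ j * (phi (j + 1) : ℝ) +
      if j = 0 then 1 / 2 * e + 1 / 2 else 0)
    (fun j => by
      rw [hK]
      refine add_nonneg (by split_ifs <;> simp [hm0]) (by positivity))
    (fun j => by
      rw [hK, mul_add, add_comm]
      refine add_le_add (le_of_eq ?_) ?_
      · push_cast
        simp only [div_pow, one_pow, mul_pow, pow_add, pow_one, two_mul]
        field_simp
      · split_ifs with hj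
        · subst hj
          refine hm1.trans (le_of_eq ?_)
          rw [zero_add, pow_one]
          field_simp
        · simp) (N + 1)
  refine h2.trans (le_of_eq ?_)
  rw [eval_momentPoly, momentSeq_succ_eq]
  simp only [Matrix.cons_val]
  rw [one_div_pow]
  ring

end Bounds

end BNS

theorem mainTheorem9 :
    ∃ (f : ℕ → MvPolynomial (Fin 4) ℝ) (g : ℕ → MvPolynomial (Fin 6) ℝ),
      (∀ N m, 0 ≤ (f N).coeff m) ∧ (∀ N m, 0 ≤ (g N).coeff m) ∧
      ∀ (Ω : Type*) [MeasurableSpace Ω] (Q : Measure Ω) [IsProbabilityMeasure Q]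
        (Z V : ℝ≥0 → Ω → ℝ) (lam T : ℝ≥0) (a b v₀ : ℝ),
        0 < lam → 0 < T → 0 < a → 0 < b → 0 < v₀ →
        BNS.IsInverseGaussianOU Q lam a b v₀ Z V →
        -- central moments of the integrated variance
        (Integrable (BNS.integrated V T) Q ∧
          ∀ N : ℕ, 1 ≤ N →
            Integrable (fun ω => (BNS.integrated V T ω - ∫ ω', BNS.integrated V T ω' ∂Q) ^ N) Q ∧
            |∫ ω, (BNS.integrated V T ω - ∫ ω', BNS.integrated V T ω' ∂Q) ^ N ∂Q|
              ≤ a * T / (lam * b ^ (N + 1)) *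
                (f N).eval ![a, 1 / (lam : ℝ), 1 / b, (T : ℝ)]) ∧
        -- the quantities `G_N`
        (∀ ρ : ℝ, ρ ≤ 0 → ∀ N : ℕ, 1 ≤ N →
          Integrable (fun ω => BNS.boundVariable Q Z lam T ρ ω ^ N) Q ∧
          BNS.G Q Z lam T ρ N
            ≤ a * lam * T * |ρ| / b ^ N *
              (g N).eval ![a, (lam : ℝ), 1 / b, (T : ℝ), |ρ|,
                Real.exp (-(lam * T * BNS.kappa Q Z ρ))]) ∧
        -- the derivatives of the cumulant generating function at the origin
        (∀ i : ℕ, 1 ≤ i →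
          iteratedDeriv i (BNS.kappa Q Z) 0 = BNS.phi i * a / b ^ (2 * i - 1)) := by
  refine ⟨fun N => (BNS.centralMomentPoly N).map NNReal.toRealHom,
    fun N => (BNS.momentPoly N).map NNReal.toRealHom, fun N m => ?_, fun N m => ?_, ?_⟩
  · rw [MvPolynomial.coeff_map]; exact NNReal.coe_nonneg _
  · rw [MvPolynomial.coeff_map]; exact NNReal.coe_nonneg _
  intro Ω _ Q _ Z V lam T a b v₀ hlam _ ha hb hv₀ h
  refine ⟨⟨(BNS.integrated_central_moments hlam ha hb hv₀ h 0).1, fun N hN => ?_⟩,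
    fun ρ hρ N hN => ?_, fun i hi => ?_⟩
  · obtain ⟨n, rfl⟩ := Nat.exists_eq_add_of_le' hN
    exact (BNS.integrated_central_moments hlam ha hb hv₀ h n).2
  · obtain ⟨n, rfl⟩ := Nat.exists_eq_add_of_le' hN
    exact BNS.boundVariable_moments hlam ha hb h.subordinator h.stationary hρ n
  · obtain ⟨j, rfl⟩ := Nat.exists_eq_add_of_le' hi
    rw [BNS.iteratedDeriv_kappa h.subordinator hlam ha hb h.stationary]
    congr 2
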